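/- Let $n\ge 1$ and, for $s>0$, let $B_c(0,s)\subset\mathbb C^n$ be the open Euclidean ball of radius $s$ centred at $0$. Let $1<r_1<r$. A plurisubharmonic function on $B_c(0,r)$ is an upper semicontinuous function with values in $[-\infty,\infty)$ that satisfies the sub-mean value inequality on every closed complex disc $\{a+\zeta w:\ |\zeta|\le 1\}\subset B_c(0,r)$ (the function $\equiv-\infty$ is allowed). For such an $f$ and a complex affine line $l\subset\mathbb C^n$ with $l\cap B_c(0,1)\neq\emptyset$ put $$b_f(l,r_1)=\sup_{l\cap B_c(0,r_1)}f-\sup_{l\cap B_c(0,1)}f ,$$ with $b_f(l,r_1)=0$ if $f\equiv-\infty$ on $l\cap B_c(0,r_1)$, and let the Bernstein index $b_f(r_1)$ be the supremum of $b_f(l,r_1)$ over all such lines $l$. **Theorem.** For all $1<r_1<r$ there is a constant $c\ge 1$, depending only on $r_1$ and $r$ (in particular not on $n$), such that for every $n\ge 1$ and every plurisubharmonic function $f$ on $B_c(0,r)\subset\mathbb C^n$ with $b_f(r_1)<\infty$ the function $F=e^f$ (with $e^{-\infty}=0$) satisfies $$\sup_I F\le\left(\frac{4|I|}{|\omega|}\right)^{c\,b_f(r_1)}\sup_\omega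 F$$ for every real interval $I$ contained in $B_c(0,1)$ (a bounded interval of a real affine line in $\mathbb C^n\cong\mathbb R^{2n}$) and every Lebesgue measurable subset $\omega\subset I$ with $|\omega|>0$, where $|\cdot|$ is the length (one-dimensional Lebesgue measure) on the line. -/

import Mathlib

open Set MeasureTheory Metric

/-- The mean over `[0, 2π]` of an extended-real valued function: the mean of its positive part
minus the mean of its negative part (it is meaningful, with values in `[-∞, ∞)`, for measurable
functions that are bounded above, and equals `-∞` exactly when the negative part has infinite
integral). -/
noncomputable def angularMean (g : ℝ → EReal) : EReal :=
  (((∫⁻ θ in Ioc 0 (2 * Real.pi), (g θ).toENNReal) / ENNReal.ofReal (2 * Real.pi) : ENNReal) : EReal)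
    - (((∫⁻ θ in Ioc 0 (2 * Real.pi), (-g θ).toENNReal) / ENNReal.ofReal (2 * Real.pi) : ENNReal)
      : EReal)

/-- `f` is plurisubharmonic on the (open) set `Ω ⊆ ℂⁿ`: it is upper semicontinuous on `Ω` with
values in `[-∞, ∞)` there, and satisfies the sub-mean value inequality on every closed complex
disc `{a + ζ w : |ζ| ≤ 1}` contained in `Ω`. The function `-∞` is allowed. -/
structure IsPlurisubharmonicOn {n : ℕ} (f : EuclideanSpace ℂ (Fin n) → EReal)
    (Ω : Set (EuclideanSpace ℂ (Fin n))) : Prop where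
  upperSemicontinuousOn : UpperSemicontinuousOn f Ω
  ne_top : ∀ z ∈ Ω, f z ≠ ⊤
  le_mean : ∀ a w : EuclideanSpace ℂ (Fin n),
    (∀ ζ : ℂ, ‖ζ‖ ≤ 1 → a + ζ • w ∈ Ω) →
      f a ≤ angularMean fun θ => f (a + Complex.exp (θ * Complex.I) • w)

open Classical in
/-- The Bernstein index of `f` on the complex line `l`:
`sup_{l ∩ B(0,r₁)} f - sup_{l ∩ B(0,1)} f`, and `0` if `f` is identically `-∞` on `l ∩ B(0,r₁)`
(the difference would be `-∞ - (-∞)`). -/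
noncomputable def lineBernsteinIndex {n : ℕ} (f : EuclideanSpace ℂ (Fin n) → EReal)
    (r₁ : ℝ) (l : AffineSubspace ℂ (EuclideanSpace ℂ (Fin n))) : EReal :=
  if ∀ z ∈ (l : Set (EuclideanSpace ℂ (Fin n))) ∩ ball 0 r₁, f z = ⊥ then 0
  else (⨆ z ∈ (l : Set (EuclideanSpace ℂ (Fin n))) ∩ ball 0 r₁, f z)
    - ⨆ z ∈ (l : Set (EuclideanSpace ℂ (Fin n))) ∩ ball 0 1, f z

/-- The Bernstein index `b_f(r₁)`: the supremum of the indices over all complex lines that meet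
the unit ball. -/
noncomputable def bernsteinIndex {n : ℕ} (f : EuclideanSpace ℂ (Fin n) → EReal)
    (r₁ : ℝ) : EReal :=
  ⨆ (l : AffineSubspace ℂ (EuclideanSpace ℂ (Fin n)))
    (_ : Module.finrank ℂ l.direction = 1
      ∧ ((l : Set (EuclideanSpace ℂ (Fin n))) ∩ ball 0 1).Nonempty),
    lineBernsteinIndex f r₁ l

/-- The inequality `sup_I F ≤ (4|I| / |ω|) ^ d * sup_ω F` for all real intervals `I` in the open
unit ball of `ℂⁿ` and all Lebesgue measurable `ω ⊆ I` of positive length. The interval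
(open, closed or half-open) and its subset are written as the images of `J ⊆ ℝ` and `s ⊆ J` under
the arc-length parametrization `t ↦ x + t v`, `‖v‖ = 1`, of a real line in `ℂⁿ`. -/
def SatisfiesRemez {n : ℕ} (F : EuclideanSpace ℂ (Fin n) → ENNReal) (d : ℝ) : Prop :=
  ∀ (x v : EuclideanSpace ℂ (Fin n)), ‖v‖ = 1 →
    ∀ J : Set ℝ, J.OrdConnected → (∀ t ∈ J, x + (t : ℂ) • v ∈ ball 0 1) →
      ∀ s ⊆ J, NullMeasurableSet s volume → volume s ≠ 0 →
        ⨆ t ∈ J, F (x + (t : ℂ) • v)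
          ≤ (4 * volume J / volume s) ^ d * ⨆ t ∈ s, F (x + (t : ℂ) • v)

/-! Restricted to a complex line, `f` becomes a subharmonic `u` on a planar disc, and all that is
used of the Bernstein index is that the supremum of `u` drops by at most `b` from the large disc to
the unit disc. The slice is normalized so that its part in the unit ball is exactly the unit disc,
while the disc of radius `r₁` maps into the larger ball. Hence neither the line nor the dimension
affects the constant.

The engine is the two-constants principle `IsSubharmonicOn.le_add_mul`: a bound `A` on a disc and a
bound `m` on a compact `E` give `u ≤ A + (A - m) H` off `E`, for `H` harmonic, nonnegative on the
outer circle and at least `-1`. Whenever `H` is uniformly negative on a region where `u` is known to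
be large somewhere, this bounds `A - m`. Three choices of `H` are used. The Green function shows
that `u` is not small on any fixed small disc (`exists_propagation`). The function `log |z - x|`
gives the three circles theorem, whose log-convexity carries doubling to all smaller scales
(`IsSubharmonicOn.doubling`). The logarithmic potential of length on a real set of measure `σ`
produces the loss `log (1/σ)` (`IsSubharmonicOn.sub_le_of_le_on_real`).

For a short interval, doubling allows the last estimate to be applied on a disc of size comparable
to `|I|`, so only the ratio `|I|/|ω|` survives. A long interval is cut into boundedly many pieces.
As `4|I|/|ω| ≥ 4`, additive constants are absorbed into a multiple of the logarithm. -/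

/-! ### Subharmonic functions in the plane: maximum principle and comparison. -/

/-- A function of one complex variable is subharmonic on `Ω`: upper semicontinuous, `< ∞`, and
dominated by its means over the boundaries of closed discs in `Ω`. -/
structure IsSubharmonicOn (u : ℂ → EReal) (Ω : Set ℂ) : Prop where
  upperSemicontinuousOn : UpperSemicontinuousOn u Ω
  ne_top : ∀ z ∈ Ω, u z ≠ ⊤
  le_mean : ∀ a w : ℂ, (∀ ζ : ℂ, ‖ζ‖ ≤ 1 → a + ζ * w ∈ Ω) →
    u a ≤ angularMean fun θ => u (a + Complex.exp (θ * Complex.I) * w)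

/-- Both parts of the mean of the continuous majorant are finite, so the `EReal` difference is the
ordinary mean; monotonicity of `lintegral` in each part needs no measurability of `g`. -/
theorem angularMean_le_of_le_continuous {g : ℝ → EReal} {φ : ℝ → ℝ} (hφ : Continuous φ)
    (h : ∀ θ, g θ ≤ (φ θ : EReal)) :
    angularMean g ≤ (((2 * Real.pi)⁻¹ * ∫ θ in 0..2 * Real.pi, φ θ : ℝ) : EReal) := by
  have hpi : 0 < 2 * Real.pi := Real.two_pi_pos
  set μ : Measure ℝ := volume.restrict (Ioc 0 (2 * Real.pi)) with hμ
  have hint : Integrable φ μ :=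
    (hφ.integrableOn_Icc (a := 0) (b := 2 * Real.pi)).mono_set Ioc_subset_Icc_self
  have h1 : ∫⁻ θ, (g θ).toENNReal ∂μ ≤ ∫⁻ θ, ENNReal.ofReal (φ θ) ∂μ :=
    lintegral_mono fun θ => by
      have := EReal.toENNReal_le_toENNReal (h θ)
      simpa using this
  have h2 : ∫⁻ θ, ENNReal.ofReal (-φ θ) ∂μ ≤ ∫⁻ θ, (-g θ).toENNReal ∂μ :=
    lintegral_mono fun θ => by
      have := EReal.toENNReal_le_toENNReal (EReal.neg_le_neg_iff.2 (h θ))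
      rw [← EReal.coe_neg] at this
      simpa using this
  have f1 : ∫⁻ θ, ENNReal.ofReal (φ θ) ∂μ ≠ ⊤ := hint.lintegral_lt_top.ne
  have f2 : ∫⁻ θ, ENNReal.ofReal (-φ θ) ∂μ ≠ ⊤ := hint.neg.lintegral_lt_top.ne
  have hI : (2 * Real.pi)⁻¹ * ∫ θ in 0..2 * Real.pi, φ θ
      = ((∫⁻ θ, ENNReal.ofReal (φ θ) ∂μ) / ENNReal.ofReal (2 * Real.pi)).toReal
        - ((∫⁻ θ, ENNReal.ofReal (-φ θ) ∂μ) / ENNReal.ofReal (2 * Real.pi)).toReal := by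
    rw [intervalIntegral.integral_of_le hpi.le,
      integral_eq_lintegral_pos_part_sub_lintegral_neg_part hint, ENNReal.toReal_div,
      ENNReal.toReal_div, ENNReal.toReal_ofReal hpi.le]
    ring
  have d1 : (∫⁻ θ, ENNReal.ofReal (φ θ) ∂μ) / ENNReal.ofReal (2 * Real.pi) ≠ ⊤ :=
    ENNReal.div_ne_top f1 (by simpa using hpi)
  have d2 : (∫⁻ θ, ENNReal.ofReal (-φ θ) ∂μ) / ENNReal.ofReal (2 * Real.pi) ≠ ⊤ :=
    ENNReal.div_ne_top f2 (by simpa using hpi)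
  rw [hI, EReal.coe_sub, EReal.coe_ennreal_toReal d1, EReal.coe_ennreal_toReal d2]
  unfold angularMean
  refine EReal.sub_le_sub ?_ ?_
  · exact_mod_cast ENNReal.div_le_div_right h1 _
  · exact_mod_cast ENNReal.div_le_div_right h2 _

/-- The gain `ρ ^ 2` is the strict subharmonicity that the maximum principle uses as a perturbation.
-/
theorem circleAverage_normSq (z : ℂ) (ρ : ℝ) :
    Real.circleAverage (fun ζ => Complex.normSq ζ) z ρ = Complex.normSq z + ρ ^ 2 := by
  have h : ∀ θ : ℝ, Complex.normSq (circleMap z ρ θ)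
      = (Complex.normSq z + ρ ^ 2) + ((2 * ρ * z.re) * Real.cos θ + (2 * ρ * z.im) * Real.sin θ) := by
    intro θ
    rw [Complex.normSq_apply, Complex.normSq_apply]
    simp only [circleMap, Complex.add_re, Complex.add_im, Complex.mul_re, Complex.mul_im,
      Complex.ofReal_re, Complex.ofReal_im, Complex.exp_ofReal_mul_I_re,
      Complex.exp_ofReal_mul_I_im]
    linear_combination ρ ^ 2 * Real.cos_sq_add_sin_sq θ
  rw [Real.circleAverage_def]
  simp_rw [h]
  rw [intervalIntegral.integral_add (by simp) (Continuous.intervalIntegrable (by fun_prop) _ _),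
    intervalIntegral.integral_add (Continuous.intervalIntegrable (by fun_prop) _ _)
      (Continuous.intervalIntegrable (by fun_prop) _ _)]
  have := Real.pi_ne_zero
  simp
  field_simp

theorem circleAverage_const_add_mul {H : ℂ → ℝ} {c : ℂ} {ρ : ℝ} (hH : CircleIntegrable H c ρ)
    (a b : ℝ) : Real.circleAverage (fun z => a + b * H z) c ρ = a + b * Real.circleAverage H c ρ := by
  have hH' : IntervalIntegrable (fun θ => b * H (circleMap c ρ θ)) volume 0 (2 * Real.pi) :=
    IntervalIntegrable.const_mul hH b
  rw [Real.circleAverage_def, Real.circleAverage_def, intervalIntegral.integral_add (by simp) hH',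
    intervalIntegral.integral_const_mul]
  have := Real.pi_ne_zero
  simp
  field_simp

/-- Maximum principle: `v` is a continuous function dominating its means where `u` is not
already known to be at most `v`. -/
theorem le_of_mean_inequalities {u : ℂ → EReal} {v : ℂ → ℝ} {K : Set ℂ} (hK : IsCompact K)
    (hu : UpperSemicontinuousOn u K) (htop : ∀ z ∈ K, u z ≠ ⊤) (hv : ContinuousOn v K)
    (h : ∀ z ∈ K, u z ≤ (v z : EReal) ∨ ∃ ρ > 0, closedBall z ρ ⊆ K ∧
      u z ≤ angularMean (fun θ => u (circleMap z ρ θ)) ∧ Real.circleAverage v z ρ ≤ v z) :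
    ∀ z ∈ K, u z ≤ (v z : EReal) := by
  intro z₁ hz₁
  by_contra! hlt
  obtain ⟨M, hM⟩ := hK.exists_bound_of_continuousOn
    (f := fun z => Complex.normSq z) (by exact Complex.continuous_normSq.continuousOn)
  have hb₁ : u z₁ ≠ ⊥ := (bot_le.trans_lt hlt).ne'
  obtain ⟨x₁, hx₁⟩ : ∃ x : ℝ, (x : EReal) = u z₁ := ⟨_, EReal.coe_toReal (htop z₁ hz₁) hb₁⟩
  rw [← hx₁, EReal.coe_lt_coe_iff] at hlt
  have hM0 : 0 ≤ M := (norm_nonneg _).trans (hM z₁ hz₁)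
  -- The term `ε |z|²` is too small on `K` to hide the excess of `u` over `v` at `z₁`, so a
  -- maximizer of `u - v + ε |z|²` still has `u > v`.
  obtain ⟨ε, hε, hεM⟩ : ∃ ε > 0, ε * M < x₁ - v z₁ := by
    refine ⟨(x₁ - v z₁) / (M + 1), by have := sub_pos.2 hlt; positivity, ?_⟩
    rw [div_mul_eq_mul_div, div_lt_iff₀ (by positivity)]
    have := sub_pos.2 hlt
    nlinarith
  let q : ℂ → ℝ := fun z => - v z + ε * Complex.normSq z
  have hq : ContinuousOn q K :=
    hv.neg.add (continuousOn_const.mul Complex.continuous_normSq.continuousOn)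
  have hw : UpperSemicontinuousOn (fun z => u z + (q z : EReal)) K := by
    refine hu.add' (continuous_coe_real_ereal.comp_continuousOn hq).upperSemicontinuousOn ?_
    intro z hz
    exact EReal.continuousAt_add (Or.inl (htop z hz)) (Or.inr (EReal.coe_ne_top _))
  obtain ⟨z₀, hz₀, hmax⟩ := hw.exists_isMaxOn ⟨z₁, hz₁⟩ hK
  have hle : ∀ z ∈ K, u z + (q z : EReal) ≤ u z₀ + (q z₀ : EReal) := fun z hz => hmax hz
  have h01 := hle z₁ hz₁
  have hb₀ : u z₀ ≠ ⊥ := by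
    intro hb
    rw [hb, EReal.bot_add, ← hx₁, ← EReal.coe_add, le_bot_iff] at h01
    exact EReal.coe_ne_bot _ h01
  obtain ⟨x₀, hx₀⟩ : ∃ x : ℝ, (x : EReal) = u z₀ := ⟨_, EReal.coe_toReal (htop z₀ hz₀) hb₀⟩
  rw [← hx₁, ← hx₀, ← EReal.coe_add, ← EReal.coe_add, EReal.coe_le_coe_iff] at h01
  have hn₀ : Complex.normSq z₀ ≤ M := (le_abs_self _).trans (hM z₀ hz₀)
  have hn₁ := Complex.normSq_nonneg z₁
  have hgt : v z₀ < x₀ := by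
    simp only [q] at h01
    nlinarith
  rcases h z₀ hz₀ with h' | ⟨ρ, hρ, hsub, hmean, hvm⟩
  · rw [← hx₀, EReal.coe_le_coe_iff] at h'
    exact absurd h' (not_le.2 hgt)
  · have hcirc : ∀ θ, circleMap z₀ ρ θ ∈ K := fun θ =>
      hsub (circleMap_mem_closedBall z₀ hρ.le θ)
    have hqc : Continuous fun θ => q (circleMap z₀ ρ θ) :=
      hq.comp_continuous (continuous_circleMap z₀ ρ) hcirc
    have hvc : Continuous fun θ => v (circleMap z₀ ρ θ) :=
      hv.comp_continuous (continuous_circleMap z₀ ρ) hcirc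
    have hb : ∀ θ, u (circleMap z₀ ρ θ) ≤ ((x₀ + q z₀ - q (circleMap z₀ ρ θ) : ℝ) : EReal) := by
      intro θ
      have := hle _ (hcirc θ)
      rw [← hx₀, ← EReal.coe_add] at this
      rw [EReal.coe_sub]
      exact EReal.le_sub_iff_add_le (Or.inl (EReal.coe_ne_bot _))
        (Or.inl (EReal.coe_ne_top _)) |>.2 this
    -- Averaging the maximality bound over the circle around `z₀` would force `ε ρ² ≤ 0`.
    have hav := hmean.trans (angularMean_le_of_le_continuous
      (φ := fun θ => x₀ + q z₀ - q (circleMap z₀ ρ θ)) (continuous_const.sub hqc) hb)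
    rw [← hx₀, EReal.coe_le_coe_iff] at hav
    have hn := circleAverage_normSq z₀ ρ
    rw [Real.circleAverage_def, smul_eq_mul] at hn hvm
    have hnc : Continuous fun θ => Complex.normSq (circleMap z₀ ρ θ) :=
      Complex.continuous_normSq.comp (continuous_circleMap z₀ ρ)
    have hcalc : (2 * Real.pi)⁻¹ * ∫ θ in 0..2 * Real.pi, (x₀ + q z₀ - q (circleMap z₀ ρ θ))
        = x₀ + q z₀ + ((2 * Real.pi)⁻¹ * ∫ θ in 0..2 * Real.pi, v (circleMap z₀ ρ θ))
          - ε * ((2 * Real.pi)⁻¹ * ∫ θ in 0..2 * Real.pi, Complex.normSq (circleMap z₀ ρ θ)) := by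
      have : ∀ θ, x₀ + q z₀ - q (circleMap z₀ ρ θ) = (x₀ + q z₀) + (v (circleMap z₀ ρ θ)
          - ε * Complex.normSq (circleMap z₀ ρ θ)) := by
        intro θ; simp only [q]; ring
      simp_rw [this]
      have hεc : Continuous fun θ => ε * Complex.normSq (circleMap z₀ ρ θ) :=
        continuous_const.mul hnc
      have hdc : Continuous fun θ => v (circleMap z₀ ρ θ) - ε * Complex.normSq (circleMap z₀ ρ θ) :=
        hvc.sub hεc
      rw [intervalIntegral.integral_add (by simp) (hdc.intervalIntegrable _ _),
        intervalIntegral.integral_sub (hvc.intervalIntegrable _ _) (hεc.intervalIntegrable _ _),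
        intervalIntegral.integral_const_mul]
      have := Real.pi_ne_zero
      simp
      field_simp
      ring
    rw [hcalc, hn] at hav
    simp only [q] at hav
    have : 0 < ε * ρ ^ 2 := by positivity
    linarith

/-- Comparison of a subharmonic function with a harmonic function on a disc minus a compact
set. -/
theorem IsSubharmonicOn.le_add_mul {u : ℂ → EReal} {Ω : Set ℂ} (hu : IsSubharmonicOn u Ω)
    {x : ℂ} {R A m : ℝ} (hΩ : closedBall x R ⊆ Ω) (hmA : m ≤ A) {E : Set ℂ} (hE : IsCompact E)
    (hER : E ⊆ closedBall x R)
    (hA : ∀ z ∈ closedBall x R, u z ≤ A) (hm : ∀ z ∈ E, u z ≤ m) {H : ℂ → ℝ}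
    (hHc : ContinuousOn H (closedBall x R \ E))
    (hHm : ∀ z ρ, 0 < ρ → closedBall z ρ ⊆ closedBall x R \ E → Real.circleAverage H z ρ = H z)
    (hH0 : ∀ z ∈ sphere x R, z ∉ E → 0 ≤ H z) (hH1 : ∀ z ∈ closedBall x R \ E, -1 ≤ H z) :
    ∀ z ∈ closedBall x R \ E, u z ≤ ((A + (A - m) * H z : ℝ) : EReal) := by
  intro z₁ hz₁
  refine EReal.le_of_forall_lt_iff_le.1 fun y hy => ?_
  rw [EReal.coe_lt_coe_iff] at hy
  set ε := y - (A + (A - m) * H z₁) with hε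
  have hε0 : 0 < ε := sub_pos.2 hy
  have husc : UpperSemicontinuousOn u (closedBall x R) := hu.upperSemicontinuousOn.mono hΩ
  -- Nothing is assumed about the continuity of `H` at `E`. Upper semicontinuity gives `u < m + ε`
  -- near `E`, and there `H ≥ -1` already suffices.
  obtain ⟨U, hUo, hEU, hU⟩ : ∃ U : Set ℂ, IsOpen U ∧ E ⊆ U ∧
      ∀ z ∈ U ∩ closedBall x R, u z < ((m + ε : ℝ) : EReal) := by
    have hp : ∀ z ∈ E, ∃ V : Set ℂ, IsOpen V ∧ z ∈ V ∧
        ∀ w ∈ V ∩ closedBall x R, u w < ((m + ε : ℝ) : EReal) := by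
      intro z hz
      have h1 : u z < ((m + ε : ℝ) : EReal) :=
        (hm z hz).trans_lt (EReal.coe_lt_coe_iff.2 (by linarith))
      have h2 := husc z (hER hz) _ h1
      rw [eventually_nhdsWithin_iff, _root_.eventually_nhds_iff] at h2
      obtain ⟨V, hV, hVo, hzV⟩ := h2
      exact ⟨V, hVo, hzV, fun w hw => hV w hw.1 hw.2⟩
    choose! V hVo hzV hV using hp
    refine ⟨⋃ z ∈ E, V z, isOpen_biUnion hVo, fun z hz => mem_biUnion hz (hzV z hz), ?_⟩
    rintro w ⟨hw, hwR⟩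
    obtain ⟨z, hz, hwz⟩ := mem_iUnion₂.1 hw
    exact hV z hz w ⟨hwz, hwR⟩
  obtain ⟨δ, hδ, hδU⟩ := hE.exists_cthickening_subset_open hUo hEU
  have hcase : ∀ z ∈ closedBall x R \ E, z ∈ U →
      u z ≤ ((A + (A - m) * H z + ε : ℝ) : EReal) := by
    intro z hz hzU
    refine (hU z ⟨hzU, hz.1⟩).le.trans (EReal.coe_le_coe_iff.2 ?_)
    have := hH1 z hz
    nlinarith [sub_nonneg.2 hmA]
  by_cases hzU : z₁ ∈ U
  · refine (hcase z₁ hz₁ hzU).trans (EReal.coe_le_coe_iff.2 ?_)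
    rw [hε]; linarith
  -- Points of the disc outside `U` are farther than `δ` from `E`, so discs of radius at most `δ /
  -- 2` about them avoid the removed neighbourhood.
  set K : Set ℂ := closedBall x R \ thickening (δ / 2) E with hKdef
  have hKc : IsCompact K := (isCompact_closedBall x R).diff isOpen_thickening
  have hKs : K ⊆ closedBall x R \ E := fun z hz =>
    ⟨hz.1, fun h => hz.2 (self_subset_thickening (by positivity) E h)⟩
  have hz₁K : z₁ ∈ K := ⟨hz₁.1, fun h => hzU (hδU
    ((thickening_subset_cthickening_of_le (by linarith) E) h))⟩
  have key := le_of_mean_inequalities (u := u)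
    (v := fun z => A + (A - m) * H z + ε) hKc (husc.mono fun z hz => hz.1)
    (fun z hz => hu.ne_top z (hΩ hz.1))
    ((continuousOn_const.add (continuousOn_const.mul (hHc.mono hKs))).add continuousOn_const) ?_
    z₁ hz₁K
  · refine key.trans (EReal.coe_le_coe_iff.2 ?_)
    rw [hε]; linarith
  · intro z hz
    by_cases hzU' : z ∈ U
    · exact Or.inl (hcase z (hKs hz) hzU')
    by_cases hzs : dist z x = R
    · left
      refine (hA z hz.1).trans (EReal.coe_le_coe_iff.2 ?_)
      have := hH0 z hzs (hKs hz).2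
      nlinarith [sub_nonneg.2 hmA, mul_nonneg (sub_nonneg.2 hmA) this]
    right
    have hlt : dist z x < R := lt_of_le_of_ne hz.1 hzs
    have hρ : 0 < min (R - dist z x) (δ / 2) := lt_min (by linarith) (by positivity)
    have hsub : closedBall z (min (R - dist z x) (δ / 2)) ⊆ K := by
      intro w hw
      rw [mem_closedBall] at hw
      refine ⟨?_, fun hwt => hzU' ?_⟩
      · rw [mem_closedBall]
        have := dist_triangle w z x
        have := min_le_left (R - dist z x) (δ / 2)
        linarith
      · obtain ⟨e, he, hde⟩ := mem_thickening_iff.1 hwt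
        refine hδU (thickening_subset_cthickening δ E (mem_thickening_iff.2 ⟨e, he, ?_⟩))
        have h1 := dist_triangle z w e
        have h2 := min_le_right (R - dist z x) (δ / 2)
        rw [dist_comm z w] at h1
        linarith
    refine ⟨_, hρ, hsub, ?_, ?_⟩
    · have := hu.le_mean z ((min (R - dist z x) (δ / 2) : ℝ) : ℂ) ?_
      · simpa only [circleMap, mul_comm] using this
      · intro ζ hζ
        refine hΩ (hsub ?_).1
        rw [mem_closedBall, dist_eq_norm, add_sub_cancel_left, norm_mul, Complex.norm_real,
          Real.norm_of_nonneg hρ.le]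
        exact mul_le_of_le_one_left hρ.le hζ
    · have hHci : CircleIntegrable H z (min (R - dist z x) (δ / 2)) :=
        ContinuousOn.circleIntegrable hρ.le
          (hHc.mono (sphere_subset_closedBall.trans (hsub.trans hKs)))
      refine (le_of_eq ?_ : Real.circleAverage (fun z => A + (A - m) * H z + ε) z _ ≤ _)
      have : (fun z => A + (A - m) * H z + ε) = fun z => (A + ε) + (A - m) * H z := by
        ext; ring
      rw [this, circleAverage_const_add_mul hHci, hHm z _ hρ (hsub.trans hKs)]
      ring

theorem circleAverage_log_norm_of_analyticOnNhd {f : ℂ → ℂ} {z : ℂ} {ρ : ℝ} (hρ : 0 ≤ ρ)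
    (hf : AnalyticOnNhd ℂ f (closedBall z ρ)) (h0 : ∀ w ∈ closedBall z ρ, f w ≠ 0) :
    Real.circleAverage (fun w => Real.log ‖f w‖) z ρ = Real.log ‖f z‖ := by
  refine InnerProductSpace.HarmonicOnNhd.circleAverage_eq (f := fun w => Real.log ‖f w‖)
    fun w hw => ?_
  rw [abs_of_nonneg hρ] at hw
  exact (hf w hw).harmonicAt_log_norm (h0 w hw)

/-- Two-constants theorem with the explicit comparison function `log ‖f‖`. -/
theorem IsSubharmonicOn.le_add_log_norm {u : ℂ → EReal} {Ω : Set ℂ} (hu : IsSubharmonicOn u Ω)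
    {x : ℂ} {R A m L : ℝ} (hΩ : closedBall x R ⊆ Ω) (hmA : m ≤ A) {E : Set ℂ} (hE : IsCompact E)
    (hER : E ⊆ closedBall x R) (hA : ∀ z ∈ closedBall x R, u z ≤ A) (hm : ∀ z ∈ E, u z ≤ m)
    {f : ℂ → ℂ} (hf : AnalyticOnNhd ℂ f (closedBall x R)) (hL : 0 < L)
    (hf1 : ∀ z ∈ sphere x R, 1 ≤ ‖f z‖)
    (hf2 : ∀ z ∈ closedBall x R \ E, Real.exp (-L) ≤ ‖f z‖) :
    ∀ z ∈ closedBall x R \ E, u z ≤ ((A + (A - m) * (Real.log ‖f z‖ / L) : ℝ) : EReal) := by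
  have h0 : ∀ z ∈ closedBall x R \ E, f z ≠ 0 := fun z hz h => by
    have := hf2 z hz
    rw [h, norm_zero] at this
    exact absurd this (not_le.2 (Real.exp_pos _))
  have hc : ContinuousOn (fun z => Real.log ‖f z‖) (closedBall x R \ E) :=
    ((hf.continuousOn.mono sdiff_subset).norm).log fun z hz => norm_ne_zero_iff.2 (h0 z hz)
  refine hu.le_add_mul hΩ hmA hE hER hA hm (H := fun z => Real.log ‖f z‖ / L)
    (hc.div_const _) ?_ ?_ ?_
  · intro z ρ hρ hs
    have h1 := circleAverage_log_norm_of_analyticOnNhd hρ.le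
      (fun w hw => hf w (hs hw).1) (fun w hw => h0 w (hs hw))
    have h2 := circleAverage_const_add_mul (H := fun z => Real.log ‖f z‖) (c := z) (ρ := ρ)
      (ContinuousOn.circleIntegrable hρ.le (hc.mono (sphere_subset_closedBall.trans hs))) 0 L⁻¹
    simp only [zero_add] at h2
    simp only [div_eq_inv_mul]
    rw [h2, h1]
  · intro z hz _
    exact div_nonneg (Real.log_nonneg (hf1 z hz)) hL.le
  · intro z hz
    rw [le_div_iff₀ hL, neg_one_mul, Real.le_log_iff_exp_le (norm_pos_iff.2 (h0 z hz))]
    exact hf2 z hz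

/-! ### Three circles and propagation of lower bounds. -/

/-- Three circles theorem. -/
theorem IsSubharmonicOn.three_circles {u : ℂ → EReal} {Ω : Set ℂ} (hu : IsSubharmonicOn u Ω)
    {x : ℂ} {ρ R A m : ℝ} (hΩ : closedBall x R ⊆ Ω) (hρ : 0 < ρ) (hρR : ρ < R) (hmA : m ≤ A)
    (hA : ∀ z ∈ closedBall x R, u z ≤ A) (hm : ∀ z ∈ closedBall x ρ, u z ≤ m) {t : ℝ}
    (hρt : ρ ≤ t) :
    ∀ z ∈ closedBall x R, dist z x ≤ t →
      u z ≤ ((A + (A - m) * (Real.log (t / R) / Real.log (R / ρ)) : ℝ) : EReal) := by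
  intro z hz hzt
  have hR : 0 < R := hρ.trans hρR
  have hL : 0 < Real.log (R / ρ) := Real.log_pos ((one_lt_div hρ).2 hρR)
  have hexp : Real.exp (-Real.log (R / ρ)) = ρ / R := by
    rw [← Real.log_inv, Real.exp_log (by positivity), inv_div]
  by_cases hzE : z ∈ closedBall x ρ
  · refine (hm z hzE).trans (EReal.coe_le_coe_iff.2 ?_)
    have : -1 ≤ Real.log (t / R) / Real.log (R / ρ) := by
      rw [le_div_iff₀ hL, neg_one_mul, Real.le_log_iff_exp_le
        (div_pos (hρ.trans_le hρt) hR), hexp]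
      gcongr
    nlinarith [sub_nonneg.2 hmA]
  have hn : ∀ w, ‖(w - x) / (R : ℂ)‖ = dist w x / R := fun w => by
    rw [norm_div, Complex.norm_real, Real.norm_of_nonneg hR.le, dist_eq_norm]
  have key := hu.le_add_log_norm hΩ hmA (isCompact_closedBall x ρ)
    (closedBall_subset_closedBall hρR.le) hA hm (f := fun w => (w - x) / (R : ℂ))
    (fun w _ => by fun_prop) hL ?_ ?_ z ⟨hz, hzE⟩
  · refine key.trans (EReal.coe_le_coe_iff.2 ?_)
    simp only [hn]
    have hd : 0 < dist z x := hρ.trans (not_le.1 hzE)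
    have := sub_nonneg.2 hmA
    gcongr
  · intro w hw
    rw [hn, mem_sphere.1 hw, div_self hR.ne']
  · intro w hw
    rw [hn, hexp]
    have : ρ ≤ dist w x := (not_le.1 hw.2).le
    gcongr

/-- The Green function of the disc of radius `R` bounds how small a subharmonic function can be
on a small disc. -/
theorem exists_propagation (R δ : ℝ) (hR : 1 < R) (hδ : 0 < δ) (hδR : δ ≤ R - 1) :
    ∃ C : ℝ, 1 ≤ C ∧ ∀ (u : ℂ → EReal) (Ω : Set ℂ), IsSubharmonicOn u Ω → closedBall 0 R ⊆ Ω →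
      ∀ A b : ℝ, (∀ z ∈ closedBall 0 R, u z ≤ A) →
        (∀ m : ℝ, (∀ z ∈ ball 0 1, u z ≤ m) → A - b ≤ m) →
        ∀ x ∈ ball (0 : ℂ) 1, ∀ m : ℝ, (∀ z ∈ closedBall x δ, u z ≤ m) → A - C * b ≤ m := by
  set L : ℝ := Real.log ((R + 1) / δ) with hLdef
  have hR0 : 0 < R := by linarith
  have hL : 0 < L := Real.log_pos ((one_lt_div hδ).2 (by linarith))
  -- The quotient bounds `1 - |f|²` from below on the unit disc for the Blaschke factor `f` with
  -- zero `x`; the minimum with `1` covers the points inside the small disc.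
  set κ : ℝ := min 1 (((R ^ 2 - 1) ^ 2 / (R ^ 2 + R) ^ 2) / (2 * L)) with hκdef
  have hκ : 0 < κ := lt_min one_pos (by
    have : 0 < R ^ 2 - 1 := by nlinarith
    positivity)
  have hκ1 : κ ≤ 1 := min_le_left _ _
  refine ⟨κ⁻¹, (one_le_inv₀ hκ).2 hκ1, ?_⟩
  intro u Ω hu hΩ A b hA hb x hx m hm
  rw [mem_ball_zero_iff] at hx
  have hb0 : 0 ≤ b := by
    have := hb A fun z hz => hA z (mem_closedBall_zero_iff.2
      ((mem_ball_zero_iff.1 hz).le.trans hR.le))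
    linarith
  by_cases hmA : A < m
  · have : 0 ≤ κ⁻¹ * b := by positivity
    linarith
  rw [not_lt] at hmA
  have hER : closedBall x δ ⊆ closedBall 0 R := by
    refine closedBall_subset_closedBall' ?_
    rw [dist_zero_right]; linarith
  -- `R (z - x) / D z` is the Blaschke factor of the disc of radius `R`: its modulus is `1` on the
  -- boundary, and minus its logarithm is the Green function with pole `x`.
  set D : ℂ → ℂ := fun z => (R : ℂ) ^ 2 - starRingEnd ℂ x * z with hD
  have hDlow : ∀ z ∈ closedBall (0 : ℂ) R, R ^ 2 - R ≤ ‖D z‖ := by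
    intro z hz
    rw [mem_closedBall_zero_iff] at hz
    have h1 := norm_sub_norm_le ((R : ℂ) ^ 2) (starRingEnd ℂ x * z)
    rw [norm_pow, Complex.norm_real, Real.norm_of_nonneg hR0.le, norm_mul, RCLike.norm_conj] at h1
    have : ‖x‖ * ‖z‖ ≤ 1 * R := by gcongr
    linarith
  have hDup : ∀ z ∈ closedBall (0 : ℂ) R, ‖D z‖ ≤ R ^ 2 + R := by
    intro z hz
    rw [mem_closedBall_zero_iff] at hz
    have h1 := norm_sub_le ((R : ℂ) ^ 2) (starRingEnd ℂ x * z)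
    rw [norm_pow, Complex.norm_real, Real.norm_of_nonneg hR0.le, norm_mul, RCLike.norm_conj] at h1
    have : ‖x‖ * ‖z‖ ≤ 1 * R := by gcongr
    linarith
  have hRR : 0 < R ^ 2 - R := by nlinarith
  have hD0 : ∀ z ∈ closedBall (0 : ℂ) R, 0 < ‖D z‖ := fun z hz => hRR.trans_le (hDlow z hz)
  have hid : ∀ z, ‖D z‖ ^ 2 - (R * ‖z - x‖) ^ 2 = (R ^ 2 - ‖x‖ ^ 2) * (R ^ 2 - ‖z‖ ^ 2) := by
    intro z
    rw [mul_pow, ← Complex.normSq_eq_norm_sq, ← Complex.normSq_eq_norm_sq,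
      ← Complex.normSq_eq_norm_sq, ← Complex.normSq_eq_norm_sq]
    simp only [hD, Complex.normSq_apply, ← Complex.ofReal_pow, Complex.sub_re, Complex.sub_im,
      Complex.mul_re, Complex.mul_im, Complex.conj_re, Complex.conj_im, Complex.ofReal_re,
      Complex.ofReal_im]
    ring
  have hn : ∀ z, ‖(R : ℂ) * (z - x) / D z‖ = R * ‖z - x‖ / ‖D z‖ := fun z => by
    rw [norm_div, norm_mul, Complex.norm_real, Real.norm_of_nonneg hR0.le]
  have key := hu.le_add_log_norm hΩ hmA (isCompact_closedBall x δ) hER hA hm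
    (f := fun z => (R : ℂ) * (z - x) / D z) (L := L) ?_ hL ?_ ?_
  · have := hb (A - κ * (A - m)) fun z hz => ?_
    · have h2 : A - m ≤ κ⁻¹ * b := by
        rw [← div_eq_inv_mul, le_div_iff₀ hκ]
        linarith
      linarith
    rw [mem_ball_zero_iff] at hz
    have hzR : z ∈ closedBall (0 : ℂ) R := mem_closedBall_zero_iff.2 (hz.le.trans hR.le)
    by_cases hzE : z ∈ closedBall x δ
    · refine (hm z hzE).trans (EReal.coe_le_coe_iff.2 ?_)
      nlinarith [sub_nonneg.2 hmA]
    refine (key z ⟨hzR, hzE⟩).trans (EReal.coe_le_coe_iff.2 ?_)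
    have hzx : 0 < ‖z - x‖ := by
      rw [← dist_eq_norm]; exact hδ.trans (not_le.1 hzE)
    have hlog : Real.log ‖(R : ℂ) * (z - x) / D z‖ ≤ - (κ * L) := by
      rw [hn]
      have hq : 0 < R * ‖z - x‖ / ‖D z‖ := div_pos (by positivity) (hD0 z hzR)
      have h1 : 2 * Real.log (R * ‖z - x‖ / ‖D z‖) ≤ (R * ‖z - x‖ / ‖D z‖) ^ 2 - 1 := by
        have := Real.log_le_sub_one_of_pos (pow_pos hq 2)
        rwa [Real.log_pow, Nat.cast_ofNat] at this
      have h2 : (R * ‖z - x‖ / ‖D z‖) ^ 2 - 1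
          = - ((R ^ 2 - ‖x‖ ^ 2) * (R ^ 2 - ‖z‖ ^ 2) / ‖D z‖ ^ 2) := by
        rw [← hid]
        have := (hD0 z hzR).ne'
        field_simp
        ring
      have h3 : (R ^ 2 - 1) ^ 2 / (R ^ 2 + R) ^ 2
          ≤ (R ^ 2 - ‖x‖ ^ 2) * (R ^ 2 - ‖z‖ ^ 2) / ‖D z‖ ^ 2 := by
        have hx2 : ‖x‖ ^ 2 ≤ 1 := pow_le_one₀ (norm_nonneg _) hx.le
        have hz2 : ‖z‖ ^ 2 ≤ 1 := pow_le_one₀ (norm_nonneg _) hz.le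
        have hR2 : 0 < R ^ 2 - 1 := by nlinarith
        have := hD0 z hzR
        have := hDup z hzR
        have e1 : R ^ 2 - 1 ≤ R ^ 2 - ‖x‖ ^ 2 := by linarith
        have e2 : R ^ 2 - 1 ≤ R ^ 2 - ‖z‖ ^ 2 := by linarith
        have e3 := mul_nonneg (hR2.le.trans e1) (hR2.le.trans e2)
        rw [sq (R ^ 2 - 1)]
        exact div_le_div₀ e3 (mul_le_mul e1 e2 hR2.le (hR2.le.trans e1)) (by positivity)
          (by gcongr)
      have h4 : κ * (2 * L) ≤ (R ^ 2 - 1) ^ 2 / (R ^ 2 + R) ^ 2 :=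
        (le_div_iff₀ (by positivity)).1 (min_le_right _ _)
      linarith
    have h5 : Real.log ‖(R : ℂ) * (z - x) / D z‖ / L ≤ -κ := by
      rw [div_le_iff₀ hL]; linarith
    have := mul_le_mul_of_nonneg_left h5 (sub_nonneg.2 hmA)
    linarith
  · intro z hz
    have hne : D z ≠ 0 := norm_pos_iff.1 (hD0 z hz)
    refine AnalyticAt.div (by fun_prop) (by simp only [hD]; fun_prop) hne
  · intro z hz
    have hz' : ‖z‖ = R := by simpa using hz
    have h := hid z
    rw [hz', sub_self, mul_zero, sub_eq_zero] at h
    have h' : ‖D z‖ = R * ‖z - x‖ :=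
      (sq_eq_sq₀ (norm_nonneg _) (by positivity)).1 h
    have hp := hD0 z (sphere_subset_closedBall hz)
    rw [hn, ← h', div_self hp.ne']
  · intro z hz
    have hzx : δ < ‖z - x‖ := by
      rw [← dist_eq_norm]; exact not_le.1 hz.2
    have hp := hD0 z hz.1
    have hup := hDup z hz.1
    rw [hn, hLdef, ← Real.log_inv, Real.exp_log (by positivity), inv_div,
      div_le_div_iff₀ (by linarith) hp]
    calc δ * ‖D z‖ ≤ ‖z - x‖ * (R ^ 2 + R) := by gcongr
      _ = R * ‖z - x‖ * (R + 1) := by ring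

/-! ### Logarithmic potentials of subsets of the real line. -/

/-- The logarithmic potential of the length on a subset of the real line. -/
noncomputable def logPotential (s : Set ℝ) (z : ℂ) : ℝ := ∫ t in s, Real.log ‖z - (t : ℂ)‖

theorem continuousOn_log_norm_sub {s : Set ℝ} {z : ℂ} (hz : z ∉ ((↑) : ℝ → ℂ) '' s) :
    ContinuousOn (fun t : ℝ => Real.log ‖z - (t : ℂ)‖) s := by
  refine ContinuousOn.log (by fun_prop) fun t ht => ?_
  rw [norm_ne_zero_iff, sub_ne_zero]
  rintro rfl
  exact hz ⟨t, ht, rfl⟩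

theorem continuousOn_logPotential {s : Set ℝ} (hs : IsCompact s) :
    ContinuousOn (logPotential s) (((↑) : ℝ → ℂ) '' s)ᶜ := by
  have hE : IsClosed (((↑) : ℝ → ℂ) '' s) := (hs.image Complex.continuous_ofReal).isClosed
  intro z hz
  obtain ⟨d, hd, hsub⟩ := Metric.isOpen_iff.1 hE.isOpen_compl z hz
  -- Truncating the distance at `d / 2` makes the kernel jointly continuous and changes nothing near
  -- `z`.
  have hc : Continuous fun w : ℂ => ∫ t in s, Real.log (max ‖w - (t : ℂ)‖ (d / 2)) := by
    refine continuous_parametric_integral_of_continuous ?_ hs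
    refine Continuous.log (by fun_prop) fun p => ?_
    exact (lt_max_of_lt_right (by positivity)).ne'
  refine ContinuousAt.continuousWithinAt (hc.continuousAt.congr ?_)
  filter_upwards [ball_mem_nhds z (half_pos hd)] with w hw
  refine setIntegral_congr_fun hs.measurableSet fun t ht => ?_
  have h1 : d ≤ dist z (t : ℂ) := by
    by_contra! h
    exact hsub (mem_ball'.2 h) ⟨t, ht, rfl⟩
  have h2 : d / 2 ≤ ‖w - (t : ℂ)‖ := by
    rw [← dist_eq_norm]
    have := dist_triangle_left z (t : ℂ) w
    rw [mem_ball] at hw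
    linarith
  simp only [max_eq_left h2]

/-- Fubini applies because the kernel is continuous on the product of the circle and `s`; each `log
|z - t|` is harmonic on the disc. -/
theorem circleAverage_logPotential {s : Set ℝ} (hs : IsCompact s) {z : ℂ} {ρ : ℝ} (hρ : 0 < ρ)
    (h : closedBall z ρ ⊆ (((↑) : ℝ → ℂ) '' s)ᶜ) :
    Real.circleAverage (logPotential s) z ρ = logPotential s z := by
  have hpi : 0 < 2 * Real.pi := Real.two_pi_pos
  have hcont : ContinuousOn
      (Function.uncurry fun (θ t : ℝ) => Real.log ‖circleMap z ρ θ - (t : ℂ)‖)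
      (Icc 0 (2 * Real.pi) ×ˢ s) := by
    refine ContinuousOn.log ?_ ?_
    · exact (((continuous_circleMap z ρ).comp continuous_fst).sub
        (Complex.continuous_ofReal.comp continuous_snd)).norm.continuousOn
    · rintro ⟨θ, t⟩ ⟨-, ht⟩
      rw [norm_ne_zero_iff, sub_ne_zero]
      intro heq
      exact h (circleMap_mem_closedBall z hρ.le θ) ⟨t, ht, heq.symm⟩
  have hint : Integrable (Function.uncurry fun (θ t : ℝ) => Real.log ‖circleMap z ρ θ - (t : ℂ)‖)
      ((volume.restrict (Ioc 0 (2 * Real.pi))).prod (volume.restrict s)) := by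
    rw [Measure.prod_restrict]
    exact (hcont.integrableOn_compact (isCompact_Icc.prod hs)).mono_set
      (prod_mono Ioc_subset_Icc_self subset_rfl)
  have hmean : ∀ t ∈ s, ∫ θ in Ioc 0 (2 * Real.pi), Real.log ‖circleMap z ρ θ - (t : ℂ)‖
      = (2 * Real.pi) * Real.log ‖z - (t : ℂ)‖ := by
    intro t ht
    have := circleAverage_log_norm_of_analyticOnNhd (f := fun w => w - (t : ℂ)) hρ.le
      (fun w _ => by fun_prop) (fun w hw h0 => h hw ⟨t, ht, (sub_eq_zero.1 h0).symm⟩)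
    rw [Real.circleAverage_def, smul_eq_mul, intervalIntegral.integral_of_le hpi.le] at this
    rw [← this]
    field_simp
  rw [Real.circleAverage_def, smul_eq_mul, intervalIntegral.integral_of_le hpi.le]
  unfold logPotential
  rw [integral_integral_swap hint, setIntegral_congr_fun hs.measurableSet hmean,
    integral_const_mul]
  field_simp

/-- Only the real distance matters, and the part of `s` within `σ` of `z.re` costs at most the
integral of `log (σ / |z.re - t|)` over the whole interval of radius `σ`, which is `2σ`. -/
theorem le_logPotential {s : Set ℝ} (hs : IsCompact s) {σ : ℝ} (hσ : 0 < σ)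
    (hvol : volume.real s = σ) {z : ℂ} (hz : z ∉ ((↑) : ℝ → ℂ) '' s) :
    σ * (Real.log σ - 2) ≤ logPotential s z := by
  set g : ℝ → ℝ := fun t => (Ioc (z.re - σ) (z.re + σ)).indicator
    (fun t => Real.log σ - Real.log (z.re - t)) t with hg
  have hlogint : IntervalIntegrable (fun t => Real.log (z.re - t)) volume
      (z.re - σ) (z.re + σ) := by
    have := (intervalIntegral.intervalIntegrable_log' (a := σ) (b := -σ)).comp_sub_left z.re
    simpa using this
  have hgint : Integrable g := by
    rw [hg]
    refine IntegrableOn.integrable_indicator ?_ measurableSet_Ioc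
    rw [← intervalIntegrable_iff_integrableOn_Ioc_of_le (by linarith)]
    exact intervalIntegrable_const.sub hlogint
  -- The point `z.re` is excluded because `Real.log 0 = 0` could make `g` negative there.
  have hg0 : ∀ t, t ≠ z.re → 0 ≤ g t := by
    intro t htz
    refine indicator_apply_nonneg fun ht => ?_
    rw [sub_nonneg, ← Real.log_abs (z.re - t)]
    exact Real.log_le_log (abs_pos.2 (sub_ne_zero.2 htz.symm))
      (abs_le.2 ⟨by linarith [ht.2], by linarith [ht.1]⟩)
  have hne : ∀ᵐ t : ℝ, t ≠ z.re := by simp [ae_iff]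
  have hgI : ∫ t, g t = 2 * σ := by
    rw [hg, integral_indicator measurableSet_Ioc,
      ← intervalIntegral.integral_of_le (by linarith),
      intervalIntegral.integral_sub intervalIntegrable_const hlogint,
      intervalIntegral.integral_comp_sub_left (fun t => Real.log t) z.re, integral_log]
    simp
    ring
  have hLint : IntegrableOn (fun t : ℝ => Real.log ‖z - (t : ℂ)‖) s :=
    (continuousOn_log_norm_sub hz).integrableOn_compact hs
  have hcint : IntegrableOn (fun _ : ℝ => Real.log σ) s :=
    integrableOn_const hs.measure_lt_top.ne
  have hle : ∫ t in s, (Real.log σ - g t) ≤ ∫ t in s, Real.log ‖z - (t : ℂ)‖ := by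
    refine integral_mono_ae (hcint.sub hgint.integrableOn) hLint ?_
    filter_upwards [ae_restrict_of_ae hne] with t ht
    have h0 : z.re - t ≠ 0 := sub_ne_zero.2 ht.symm
    have hre : |z.re - t| ≤ ‖z - (t : ℂ)‖ := by
      simpa using Complex.abs_re_le_norm (z - (t : ℂ))
    have h1 : Real.log |z.re - t| ≤ Real.log ‖z - (t : ℂ)‖ := Real.log_le_log (abs_pos.2 h0) hre
    by_cases htI : t ∈ Ioc (z.re - σ) (z.re + σ)
    · simp only [hg, indicator_of_mem htI]
      rw [Real.log_abs] at h1
      linarith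
    · simp only [hg, indicator_of_notMem htI, sub_zero]
      refine le_trans (Real.log_le_log hσ ?_) h1
      rw [le_abs]
      by_contra! hcon
      exact htI ⟨by linarith, by linarith⟩
  rw [integral_sub hcint hgint.integrableOn, setIntegral_const, hvol, smul_eq_mul] at hle
  have hgs : ∫ t in s, g t ≤ ∫ t, g t :=
    setIntegral_le_integral hgint (hne.mono hg0)
  unfold logPotential
  linarith

theorem logPotential_le {s : Set ℝ} (hs : IsCompact s) {σ : ℝ} (hvol : volume.real s = σ)
    {z : ℂ} (hz : z ∉ ((↑) : ℝ → ℂ) '' s) {c : ℝ} (h : ∀ t ∈ s, ‖z - (t : ℂ)‖ ≤ c) :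
    logPotential s z ≤ σ * Real.log c := by
  have hLint := (continuousOn_log_norm_sub hz).integrableOn_compact (μ := volume) hs
  have := setIntegral_mono_on hLint (integrableOn_const (C := Real.log c) hs.measure_lt_top.ne)
    hs.measurableSet fun t ht => Real.log_le_log (norm_pos_iff.2 (sub_ne_zero.2 ?_)) (h t ht)
  · rwa [setIntegral_const, hvol, smul_eq_mul] at this
  · rintro rfl
    exact hz ⟨t, ht, rfl⟩

theorem le_logPotential_of_le {s : Set ℝ} (hs : IsCompact s) {σ : ℝ} (hvol : volume.real s = σ)
    {z : ℂ} (hz : z ∉ ((↑) : ℝ → ℂ) '' s) {c : ℝ} (hc : 0 < c) (h : ∀ t ∈ s, c ≤ ‖z - (t : ℂ)‖) :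
    σ * Real.log c ≤ logPotential s z := by
  have hLint := (continuousOn_log_norm_sub hz).integrableOn_compact (μ := volume) hs
  have := setIntegral_mono_on (integrableOn_const (C := Real.log c) hs.measure_lt_top.ne) hLint
    hs.measurableSet fun t ht => Real.log_le_log hc (h t ht)
  rwa [setIntegral_const, hvol, smul_eq_mul] at this

/-- A subharmonic function on the disc of radius `8` that is not small on the disc of radius `2`
is not small on a real set in `[-1, 1]` of given length. -/
theorem IsSubharmonicOn.sub_le_of_le_on_real {u : ℂ → EReal} {Ω : Set ℂ}
    (hu : IsSubharmonicOn u Ω) (hΩ : closedBall 0 8 ⊆ Ω) {A B : ℝ}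
    (hA : ∀ z ∈ closedBall 0 8, u z ≤ A)
    (hB : ∀ m : ℝ, (∀ z ∈ closedBall 0 2, u z ≤ m) → A - B ≤ m) (hB0 : 0 ≤ B) {s : Set ℝ}
    (hs : IsCompact s) (hs1 : s ⊆ Icc (-1) 1) {σ : ℝ} (hσ : 0 < σ) (hvol : volume.real s = σ)
    {m : ℝ} (hm : ∀ t ∈ s, u (t : ℂ) ≤ m) :
    A - B * (2 * (2 - Real.log σ + Real.log 7)) ≤ m := by
  have hσ2 : σ ≤ 2 := by
    rw [← hvol]
    have := measureReal_mono (μ := volume) hs1 (by simp)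
    rw [Real.volume_real_Icc_of_le (by norm_num)] at this
    linarith
  have h7 : Real.log 2 < Real.log 7 := Real.log_lt_log (by norm_num) (by norm_num)
  have hK : 2 < 2 - Real.log σ + Real.log 7 := by
    have := Real.log_le_log hσ hσ2
    linarith
  set K : ℝ := 2 - Real.log σ + Real.log 7 with hKdef
  by_cases hmA : A < m
  · have : 0 ≤ B * (2 * K) := by positivity
    linarith
  rw [not_lt] at hmA
  have hns : ∀ t ∈ s, ‖(t : ℂ)‖ ≤ 1 := fun t ht => by
    rw [Complex.norm_real]; exact abs_le.2 (hs1 ht)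
  have hE : IsCompact (((↑) : ℝ → ℂ) '' s) := hs.image Complex.continuous_ofReal
  have hER : ((↑) : ℝ → ℂ) '' s ⊆ closedBall 0 8 := by
    rintro _ ⟨t, ht, rfl⟩
    rw [mem_closedBall_zero_iff]
    linarith [hns t ht]
  have hc : ContinuousOn (logPotential s) (closedBall 0 8 \ ((↑) : ℝ → ℂ) '' s) :=
    (continuousOn_logPotential hs).mono fun z hz => hz.2
  -- Distances to `s` are at least `7` on `|z| = 8` and at most `3` on `|z| ≤ 2`. The additive
  -- constant makes `H ≥ 0` on the outer circle, the factor `1 / K` makes `H ≥ -1`, and `log 7 - log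
  -- 3 ≥ 1 / 2` leaves `H ≤ -1 / (2K)` on the inner disc.
  have key := hu.le_add_mul hΩ hmA hE hER hA (by rintro _ ⟨t, ht, rfl⟩; exact hm t ht)
    (H := fun z => -(Real.log 7 / K) + (σ * K)⁻¹ * logPotential s z)
    (continuousOn_const.add (continuousOn_const.mul hc)) ?_ ?_ ?_
  · have := hB (A - (A - m) * (2 * K)⁻¹) fun z hz => ?_
    · have h2 : (A - m) * (2 * K)⁻¹ ≤ B := by linarith
      rw [← div_eq_mul_inv, div_le_iff₀ (by positivity)] at h2
      linarith
    by_cases hzE : z ∈ ((↑) : ℝ → ℂ) '' s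
    · obtain ⟨t, ht, rfl⟩ := hzE
      refine (hm t ht).trans (EReal.coe_le_coe_iff.2 ?_)
      have : (2 * K)⁻¹ ≤ 1 := inv_le_one_of_one_le₀ (by linarith)
      nlinarith [sub_nonneg.2 hmA]
    · rw [mem_closedBall_zero_iff] at hz
      refine (key z ⟨mem_closedBall_zero_iff.2 (by linarith), hzE⟩).trans
        (EReal.coe_le_coe_iff.2 ?_)
      have h3 := logPotential_le hs hvol hzE (c := 3) fun t ht => by
        have := norm_sub_le z (t : ℂ)
        linarith [hns t ht]
      have hlog : Real.log 3 - Real.log 7 ≤ -(1 / 2) := by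
        rw [← Real.log_div (by norm_num) (by norm_num)]
        have := Real.log_le_sub_one_of_pos (x := 3 / 7) (by norm_num)
        linarith
      have h4 : -(Real.log 7 / K) + (σ * K)⁻¹ * logPotential s z ≤ -(2 * K)⁻¹ := by
        calc -(Real.log 7 / K) + (σ * K)⁻¹ * logPotential s z
            ≤ -(Real.log 7 / K) + (σ * K)⁻¹ * (σ * Real.log 3) := by gcongr
          _ = (Real.log 3 - Real.log 7) * K⁻¹ := by field_simp; ring
          _ ≤ -(1 / 2) * K⁻¹ := by gcongr
          _ = -(2 * K)⁻¹ := by rw [mul_inv]; ring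
      have := mul_le_mul_of_nonneg_left h4 (sub_nonneg.2 hmA)
      linarith
  · intro z ρ hρ hsub
    rw [circleAverage_const_add_mul (ContinuousOn.circleIntegrable hρ.le
      (hc.mono (sphere_subset_closedBall.trans hsub))),
      circleAverage_logPotential hs hρ fun w hw => (hsub hw).2]
  · intro z hz hzE
    have h3 := le_logPotential_of_le hs hvol hzE (c := 7) (by norm_num) fun t ht => by
      have := norm_sub_norm_le z (t : ℂ)
      have hz8 : ‖z‖ = 8 := by simpa using hz
      linarith [hns t ht]
    calc (0 : ℝ) = -(Real.log 7 / K) + (σ * K)⁻¹ * (σ * Real.log 7) := by field_simp; ring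
      _ ≤ _ := by gcongr
  · intro z hz
    have h3 := le_logPotential hs hσ hvol hz.2
    calc (-1 : ℝ) = -(Real.log 7 / K) + (σ * K)⁻¹ * (σ * (Real.log σ - 2)) := by
          rw [hKdef] at hK ⊢
          field_simp
          ring
      _ ≤ _ := by gcongr

/-! ### Rescaling and doubling at small scales. -/

theorem IsSubharmonicOn.comp_affine {u : ℂ → EReal} {Ω : Set ℂ} (hu : IsSubharmonicOn u Ω)
    (a e : ℂ) : IsSubharmonicOn (fun z => u (a + z * e)) ((fun z => a + z * e) ⁻¹' Ω) where
  upperSemicontinuousOn := hu.upperSemicontinuousOn.comp (by fun_prop) (fun _ h => h)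
  ne_top z hz := hu.ne_top _ hz
  le_mean b w h := by
    have := hu.le_mean (a + b * e) (w * e) fun ζ hζ => by
      have := h ζ hζ
      rw [mem_preimage] at this
      convert this using 1
      ring
    convert this using 4
    ring

/-- Doubling at small scales follows from doubling at one scale. -/
theorem IsSubharmonicOn.doubling {u : ℂ → EReal} {Ω : Set ℂ} (hu : IsSubharmonicOn u Ω)
    {x : ℂ} {R A B ρ : ℝ} (hΩ : closedBall x R ⊆ Ω) (hA : ∀ z ∈ closedBall x R, u z ≤ A)
    (hB0 : 0 ≤ B) (hB : ∀ m : ℝ, (∀ z ∈ closedBall x (R / 2), u z ≤ m) → A - B ≤ m)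
    (hρ : 0 < ρ) (hρR : 16 * ρ < R) :
    ∃ A' : ℝ, (∀ z ∈ closedBall x (8 * ρ), u z ≤ A') ∧
      ∀ m : ℝ, (∀ z ∈ closedBall x (2 * ρ), u z ≤ m) → A' - 2 * B ≤ m := by
  have hR : 0 < R := by linarith
  set k := Real.log 2 with hk
  have hk0 : 0 < k := Real.log_pos one_lt_two
  set l := Real.log (R / (8 * ρ)) with hl
  have hl0 : 0 < l := Real.log_pos (by rw [one_lt_div (by positivity)]; linarith)
  have hsub : closedBall x (8 * ρ) ⊆ closedBall x R := closedBall_subset_closedBall (by linarith)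
  -- The drop from radius `R` to `8ρ` is at most `B / log 2` times the logarithmic ratio `l`: by
  -- log-convexity a larger drop would already show between `R` and `R / 2`.
  have hlarge : ∀ y : ℝ, y ≤ A → (∀ z ∈ closedBall x (8 * ρ), u z ≤ y) → (A - y) * k ≤ B * l := by
    intro y hyA hy
    have h1 := hB (A + (A - y) * (Real.log (R / 2 / R) / l)) fun z hz =>
      hu.three_circles hΩ (by positivity) (by linarith) hyA hA hy (by linarith) z
        (closedBall_subset_closedBall (by linarith) hz) hz
    have h2 : Real.log (R / 2 / R) = -k := by
      rw [hk, ← Real.log_inv]; congr 1; field_simp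
    rw [h2, neg_div, mul_neg, ← sub_eq_add_neg] at h1
    have h3 : (A - y) * (k / l) ≤ B := by linarith
    rwa [← mul_div_assoc, div_le_iff₀ hl0] at h3
  obtain ⟨z₀, hz₀, hmax⟩ := (hu.upperSemicontinuousOn.mono (hsub.trans hΩ)).exists_isMaxOn
    ⟨x, mem_closedBall_self (by positivity)⟩ (isCompact_closedBall x (8 * ρ))
  have hbot : u z₀ ≠ ⊥ := by
    intro hb
    have h1 := hlarge (A - (B * l / k + 1)) (by linarith [show 0 ≤ B * l / k by positivity])
      fun z hz => ((hmax hz : u z ≤ u z₀).trans hb.le).trans bot_le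
    have h2 : B * l / k * k = B * l := div_mul_cancel₀ _ hk0.ne'
    nlinarith
  obtain ⟨A', hA'⟩ : ∃ y : ℝ, (y : EReal) = u z₀ :=
    ⟨_, EReal.coe_toReal (hu.ne_top z₀ (hΩ (hsub hz₀))) hbot⟩
  have hmax' : ∀ z ∈ closedBall x (8 * ρ), u z ≤ A' := fun z hz => hA' ▸ hmax hz
  have hA'A : A' ≤ A := by
    rw [← EReal.coe_le_coe_iff, hA']; exact hA z₀ (hsub hz₀)
  refine ⟨A', hmax', fun m hm => ?_⟩
  by_cases hmA : A' < m
  · linarith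
  rw [not_lt] at hmA
  -- Convexity now bounds the drop over `[2ρ, 8ρ]`, of logarithmic length `2 log 2`, by the average
  -- slope over `[8ρ, R]`; this is the factor `2` in `2 * B`.
  have h1 := hu.three_circles hΩ (by positivity) (by linarith) (hmA.trans hA'A) hA hm
    (t := 8 * ρ) (by linarith) z₀ (hsub hz₀) hz₀
  rw [← hA', EReal.coe_le_coe_iff] at h1
  have h2 : Real.log (8 * ρ / R) = -l := by
    rw [hl, ← Real.log_inv, inv_div]
  have h3 : Real.log (R / (2 * ρ)) = l + 2 * k := by
    rw [hl, hk, ← Real.log_rpow (by norm_num), ← Real.log_mul (by positivity) (by positivity)]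
    congr 1
    norm_num
    field_simp
    norm_num
  rw [h2, h3] at h1
  have h4 : (A - m) * (l / (l + 2 * k)) ≤ A - A' := by
    rw [neg_div, mul_neg] at h1; linarith
  rw [← mul_div_assoc, div_le_iff₀ (by positivity)] at h4
  have h5 := hlarge A' hA'A hmax'
  have h6 : (A' - m) * l ≤ (2 * B) * l := by linarith
  have := le_of_mul_le_mul_right h6 hl0
  linarith

theorem real_preimage_affine {s : Set ℝ} {t₀ l : ℝ} (hl : 0 < l) :
    volume.real ((fun τ : ℝ => t₀ + τ * l) ⁻¹' s) = volume.real s / l := by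
  have : (fun τ : ℝ => t₀ + τ * l) ⁻¹' s = (fun τ => τ * l) ⁻¹' ((fun t => t₀ + t) ⁻¹' s) := rfl
  rw [this, measureReal_def, Real.volume_preimage_mul_right hl.ne', measure_preimage_add,
    ENNReal.toReal_mul, ENNReal.toReal_ofReal (by positivity), abs_of_pos (inv_pos.2 hl),
    measureReal_def]
  ring

/-- Remez-type inequality at the scale `l * ‖e‖` around the point `a + t₀ * e` of a real line. -/
theorem IsSubharmonicOn.sub_le_of_le_on_line {u : ℂ → EReal} {Ω : Set ℂ}
    (hu : IsSubharmonicOn u Ω) {a e : ℂ} {t₀ l : ℝ} (hl : 0 < l) (he : e ≠ 0)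
    (hΩ : closedBall (a + t₀ * e) (8 * (l * ‖e‖)) ⊆ Ω) {A B : ℝ}
    (hA : ∀ z ∈ closedBall (a + t₀ * e) (8 * (l * ‖e‖)), u z ≤ A)
    (hB : ∀ m : ℝ, (∀ z ∈ closedBall (a + t₀ * e) (2 * (l * ‖e‖)), u z ≤ m) → A - B ≤ m)
    (hB0 : 0 ≤ B) {s : Set ℝ} (hs : IsCompact s) (hs1 : s ⊆ Icc (t₀ - l) (t₀ + l))
    (hpos : 0 < volume.real s) {m : ℝ} (hm : ∀ t ∈ s, u (a + t * e) ≤ m) :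
    A - 2 * B * (4 + Real.log 2 + Real.log (l / volume.real s)) ≤ m := by
  have hel : (0 : ℝ) < l * ‖e‖ := mul_pos hl (norm_pos_iff.2 he)
  have hmem : ∀ (z : ℂ) (c : ℝ), z ∈ closedBall (0 : ℂ) c ↔
      (a + t₀ * e) + z * (l * e) ∈ closedBall (a + t₀ * e) (c * (l * ‖e‖)) := by
    intro z c
    rw [mem_closedBall_zero_iff, mem_closedBall, dist_eq_norm, add_sub_cancel_left, norm_mul,
      norm_mul, Complex.norm_real, Real.norm_of_nonneg hl.le, mul_le_mul_iff_left₀ hel]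
  have hU := hu.comp_affine (a + t₀ * e) (l * e)
  have hemb : Topology.IsClosedEmbedding (fun τ : ℝ => t₀ + τ * l) :=
    ((Homeomorph.mulRight₀ l hl.ne').trans (Homeomorph.addLeft t₀)).isClosedEmbedding
  have key := hU.sub_le_of_le_on_real (A := A) (B := B) (m := m)
    (s := (fun τ : ℝ => t₀ + τ * l) ⁻¹' s) (σ := volume.real s / l)
    (fun z hz => hΩ ((hmem z 8).1 hz)) (fun z hz => hA _ ((hmem z 8).1 hz)) ?_ hB0
    (hemb.isCompact_preimage hs) ?_ (by positivity) (real_preimage_affine hl) ?_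
  · have h1 : Real.log (volume.real s / l) = -Real.log (l / volume.real s) := by
      rw [← Real.log_inv, inv_div]
    rw [h1] at key
    have h7 : Real.log 7 ≤ 2 + Real.log 2 := by
      have h := Real.log_le_sub_one_of_pos (x := 7 / 4) (by norm_num)
      rw [Real.log_div (by norm_num) (by norm_num), show (4 : ℝ) = 2 * 2 by norm_num,
        Real.log_mul (by norm_num) (by norm_num)] at h
      have := Real.log_two_lt_d9
      linarith
    have := mul_le_mul_of_nonneg_left h7 (mul_nonneg zero_le_two hB0)
    linarith
  · intro m' hm'
    refine hB m' fun z hz => ?_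
    have hle : (l * e : ℂ) ≠ 0 := mul_ne_zero (by exact_mod_cast hl.ne') he
    have hzz : (a + t₀ * e) + ((z - (a + t₀ * e)) / (l * e)) * (l * e) = z := by
      rw [div_mul_cancel₀ _ hle]; ring
    have h1 := hm' ((z - (a + t₀ * e)) / (l * e)) ((hmem _ 2).2 (by rwa [hzz]))
    rwa [hzz] at h1
  · intro τ hτ
    have := hs1 hτ
    constructor
    · have : -1 * l ≤ τ * l := by linarith [this.1]
      exact le_of_mul_le_mul_right this hl
    · have : τ * l ≤ 1 * l := by linarith [this.2]
      exact le_of_mul_le_mul_right this hl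
  · intro τ hτ
    have := hm _ hτ
    convert this using 2
    push_cast
    ring

/-! ### Remez inequality on real segments in a disc. -/

/-- Pigeonhole over consecutive cells, taken closed so that a compact `k` meets them in compact
sets. -/
theorem exists_volume_real_le_mul_inter {k : Set ℝ} (hk : volume k ≠ ⊤) {c l : ℝ} {N : ℕ}
    (hl : 0 < l) (hN : 0 < N) (hsub : k ⊆ Ico c (c + N * l)) :
    ∃ i : ℕ, volume.real k ≤ N * volume.real (k ∩ Icc (c + i * l) (c + i * l + l)) := by
  by_contra! hcon
  have hcover : k ⊆ ⋃ i ∈ Finset.range N, k ∩ Icc (c + i * l) (c + i * l + l) := by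
    intro t ht
    have htc := hsub ht
    have h0 : 0 ≤ (t - c) / l := div_nonneg (by linarith [htc.1]) hl.le
    refine mem_biUnion (x := ⌊(t - c) / l⌋₊) ?_ ⟨ht, ?_, ?_⟩
    · simp only [Finset.coe_range, mem_Iio]
      rw [Nat.floor_lt h0, div_lt_iff₀ hl]
      linarith [htc.2]
    · have := Nat.floor_le h0
      rw [le_div_iff₀ hl] at this
      linarith
    · have := Nat.lt_floor_add_one ((t - c) / l)
      rw [div_lt_iff₀ hl] at this
      linarith
  have h1 : volume.real k
      ≤ ∑ i ∈ Finset.range N, volume.real (k ∩ Icc (c + i * l) (c + i * l + l)) := by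
    refine (measureReal_mono hcover ?_).trans (measureReal_biUnion_finset_le _ _)
    exact ne_top_of_le_ne_top hk (measure_mono (iUnion₂_subset fun i _ => inter_subset_left))
  have hN' : (0 : ℝ) < N := by exact_mod_cast hN
  have h2 : ∑ i ∈ Finset.range N, volume.real (k ∩ Icc (c + i * l) (c + i * l + l))
      < ∑ i ∈ Finset.range N, volume.real k / N := by
    refine Finset.sum_lt_sum_of_nonempty (Finset.nonempty_range_iff.2 hN.ne') fun i _ => ?_
    rw [lt_div_iff₀ hN']
    linarith [hcon i]
  rw [Finset.sum_const, Finset.card_range, nsmul_eq_mul, mul_div_cancel₀ _ hN'.ne'] at h2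
  linarith

/-- Inner regularity reduces to the compact sets needed for potentials; the lost factor of two
disappears in the logarithm. -/
theorem exists_isCompact_half_volume {s : Set ℝ} (hs : NullMeasurableSet s volume)
    (h0 : volume s ≠ 0) (htop : volume s ≠ ⊤) :
    ∃ k ⊆ s, IsCompact k ∧ volume.real s / 2 < volume.real k := by
  obtain ⟨t, hts, htm, hae⟩ := hs.exists_measurable_subset_ae_eq
  have hlt : volume s / 2 < volume t := by
    rw [measure_congr hae]
    exact ENNReal.half_lt_self h0 htop
  obtain ⟨k, hkt, hkc, hk⟩ := htm.exists_lt_isCompact hlt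
  refine ⟨k, hkt.trans hts, hkc, ?_⟩
  have := (ENNReal.toReal_lt_toReal (ENNReal.div_ne_top htop two_ne_zero)
    hkc.measure_lt_top.ne).2 hk
  simpa [measureReal_def, ENNReal.toReal_div] using this

/-- Remez-type inequality on real segments for subharmonic functions on a disc. -/
theorem exists_remez_constant (r₁ : ℝ) (hr₁ : 1 < r₁) :
    ∃ C : ℝ, 1 ≤ C ∧ ∀ u : ℂ → EReal, IsSubharmonicOn u (ball 0 r₁) → ∀ A b : ℝ,
      (∀ z ∈ ball 0 r₁, u z ≤ A) → (∀ m : ℝ, (∀ z ∈ ball 0 1, u z ≤ m) → A - b ≤ m) →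
      ∀ a e : ℂ, e ≠ 0 → ∀ J : Set ℝ, J.OrdConnected → (∀ t ∈ J, a + (t : ℂ) * e ∈ ball 0 1) →
      ∀ s ⊆ J, NullMeasurableSet s volume → volume s ≠ 0 →
      ∀ m : ℝ, (∀ t ∈ s, u (a + (t : ℂ) * e) ≤ m) → ∀ t ∈ J,
        u (a + (t : ℂ) * e)
          ≤ ((m + C * b * Real.log (4 * volume.real J / volume.real s) : ℝ) : EReal) := by
  set R : ℝ := (1 + r₁) / 2 with hR
  set D : ℝ := R - 1 with hD
  have hD0 : 0 < D := by rw [hD, hR]; linarith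
  have hRr : R < r₁ := by rw [hR]; linarith
  obtain ⟨C₁, hC₁, hprop⟩ := exists_propagation R (D / 16) (by linarith) (by positivity)
    (by linarith)
  -- `J` lies in an interval of length `4 / ‖e‖`, which is `128 / D` cells of length `q = D / (32
  -- ‖e‖)`.
  set N : ℕ := ⌈128 / D⌉₊ + 1 with hNdef
  have hN : 0 < N := Nat.succ_pos _
  have hN1 : (1 : ℝ) ≤ N := by exact_mod_cast hN
  have hND : 128 / D < N := by
    rw [hNdef]; push_cast
    linarith [Nat.le_ceil (128 / D)]
  have hlogN : 0 ≤ Real.log N := Real.log_nonneg hN1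
  refine ⟨4 * C₁ * (5 + Real.log N), by nlinarith, ?_⟩
  intro u hu A b hA hb a e he J hJ hJ1 s hsJ hs hs0 m hm t htJ
  have he0 : 0 < ‖e‖ := norm_pos_iff.2 he
  have hΩ : closedBall (0 : ℂ) R ⊆ ball 0 r₁ := closedBall_subset_ball hRr
  have hA' : ∀ z ∈ closedBall 0 R, u z ≤ A := fun z hz => hA z (hΩ hz)
  have hb0 : 0 ≤ b := by
    have := hb A fun z hz => hA z (ball_subset_ball hr₁.le hz)
    linarith
  have hB := fun x hx => hprop u _ hu hΩ A b hA' hb x hx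
  have hCb : 0 ≤ C₁ * b := mul_nonneg (by linarith) hb0
  -- metric facts on the interval
  have hJdist : ∀ t ∈ J, ∀ t' ∈ J, |t - t'| * ‖e‖ < 2 := by
    intro t ht t' ht'
    have h1 := dist_triangle_right (a + (t : ℂ) * e) (a + (t' : ℂ) * e) 0
    have h2 := mem_ball.1 (hJ1 t ht)
    have h3 := mem_ball.1 (hJ1 t' ht')
    have h4 : dist (a + (t : ℂ) * e) (a + (t' : ℂ) * e) = |t - t'| * ‖e‖ := by
      rw [dist_eq_norm, add_sub_add_left_eq_sub, ← sub_mul, norm_mul, ← Complex.ofReal_sub,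
        Complex.norm_real, Real.norm_eq_abs]
    linarith
  have hJsub : ∀ t' ∈ J, J ⊆ Ioo (t' - 2 / ‖e‖) (t' + 2 / ‖e‖) := by
    intro t' ht' t ht
    have := hJdist t ht t' ht'
    rw [← lt_div_iff₀ he0, abs_lt] at this
    exact ⟨by linarith [this.1], by linarith [this.2]⟩
  have hJfin : volume J ≠ ⊤ :=
    ne_top_of_le_ne_top (by simp) (measure_mono (hJsub t htJ))
  have hJle : ∀ t ∈ J, ∀ t' ∈ J, t' - t ≤ volume.real J := by
    intro t ht t' ht'
    rcases le_total t t' with h | h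
    · have := measureReal_mono (hJ.out ht ht') hJfin
      rwa [Real.volume_real_Icc_of_le h] at this
    · have : 0 ≤ volume.real J := measureReal_nonneg
      linarith
  have hsfin : volume s ≠ ⊤ := ne_top_of_le_ne_top hJfin (measure_mono hsJ)
  have hspos : 0 < volume.real s := ENNReal.toReal_pos hs0 hsfin
  have hsJle : volume.real s ≤ volume.real J := measureReal_mono hsJ hJfin
  obtain ⟨k, hks, hkc, hk⟩ := exists_isCompact_half_volume hs hs0 hsfin
  have hkpos : 0 < volume.real k := by linarith
  set l : ℝ := volume.real J with hl
  have hl0 : 0 < l := by linarith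
  set X : ℝ := 4 * l / volume.real s with hX
  have hX4 : 4 ≤ X := by
    rw [hX, le_div_iff₀ hspos]; linarith
  set y : ℝ := Real.log X with hy
  have hlog2 := Real.log_two_lt_d9
  have hlog2' := Real.log_two_gt_d9
  have hy1 : 5 / 4 ≤ y := by
    have h4 : Real.log 4 ≤ y := Real.log_le_log (by norm_num) hX4
    have : Real.log 4 = 2 * Real.log 2 := by
      rw [show (4 : ℝ) = 2 * 2 by norm_num, Real.log_mul (by norm_num) (by norm_num)]; ring
    linarith
  -- it suffices to bound a majorant of `u` on the interval
  suffices h : ∃ A₀ : ℝ, (∀ t ∈ J, u (a + (t : ℂ) * e) ≤ A₀) ∧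
      A₀ ≤ m + 4 * (C₁ * b) * (5 + Real.log N) * y by
    obtain ⟨A₀, h1, h2⟩ := h
    refine (h1 t htJ).trans (EReal.coe_le_coe_iff.2 (h2.trans (le_of_eq ?_)))
    ring
  have hball : ∀ x ∈ ball (0 : ℂ) 1, closedBall x D ⊆ closedBall 0 R := fun x hx =>
    closedBall_subset_closedBall' (by linarith [mem_ball.1 hx])
  by_cases hsmall : 16 * (l * ‖e‖) < D
  · obtain ⟨t₀, ht₀⟩ : k.Nonempty := by
      rw [nonempty_iff_ne_empty]
      rintro rfl
      simp at hkpos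
    have ht₀J := hsJ (hks ht₀)
    have hx := hJ1 t₀ ht₀J
    have hle := mul_pos hl0 he0
    obtain ⟨A₀, hA₀, hA₀m⟩ := hu.doubling (x := a + (t₀ : ℂ) * e) (R := D) (A := A)
      (B := C₁ * b) (ρ := l * ‖e‖) ((hball _ hx).trans hΩ) (fun z hz => hA' z (hball _ hx hz)) hCb
      (fun m' hm' => hB _ hx m' fun z hz => hm' z
        (closedBall_subset_closedBall (by linarith) hz)) hle hsmall
    have hJl : ∀ t ∈ J, t ∈ Icc (t₀ - l) (t₀ + l) := fun t ht =>
      ⟨by linarith [hJle t ht t₀ ht₀J], by linarith [hJle t₀ ht₀J t ht]⟩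
    have key := hu.sub_le_of_le_on_line (a := a) hl0 he
      ((closedBall_subset_closedBall (by linarith)).trans ((hball _ hx).trans hΩ))
      hA₀ hA₀m (by positivity) hkc (fun t ht => hJl t (hsJ (hks ht))) hkpos
      (fun t ht => hm t (hks ht))
    refine ⟨A₀, fun t ht => hA₀ _ ?_, ?_⟩
    · rw [mem_closedBall, dist_eq_norm, add_sub_add_left_eq_sub, ← sub_mul, norm_mul,
        ← Complex.ofReal_sub, Complex.norm_real, Real.norm_eq_abs]
      have h1 : |t - t₀| ≤ l := abs_le.2 ⟨by linarith [(hJl t ht).1], by linarith [(hJl t ht).2]⟩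
      have := mul_le_mul_of_nonneg_right h1 he0.le
      linarith
    · have h1 : Real.log (l / volume.real k) ≤ y := by
        refine Real.log_le_log (by positivity) ?_
        rw [hX, div_le_div_iff₀ hkpos hspos]
        nlinarith
      have h2 : 4 + Real.log 2 + Real.log (l / volume.real k) ≤ (5 + Real.log N) * y := by
        nlinarith
      have h3 := mul_le_mul_of_nonneg_left h2 hCb
      linarith
  · rw [not_lt] at hsmall
    -- With this `q`, the disc of radius `2 q ‖e‖` is exactly the disc of radius `D / 16` used in
    -- the propagation step, and the one of radius `8 q ‖e‖` stays within distance `D`.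
    set q : ℝ := D / (32 * ‖e‖) with hq
    have hq0 : 0 < q := by positivity
    have hqe : q * ‖e‖ = D / 32 := by rw [hq]; field_simp
    have hql : 2 * q ≤ l := by
      have : (2 * q) * ‖e‖ ≤ l * ‖e‖ := by linarith
      exact le_of_mul_le_mul_right this he0
    have hksub : k ⊆ Ico (t - 2 / ‖e‖) (t - 2 / ‖e‖ + N * q) := by
      intro t' ht'
      have h1 := hJsub t htJ (hsJ (hks ht'))
      refine ⟨h1.1.le, h1.2.trans_le ?_⟩
      have h2 : 4 / ‖e‖ ≤ N * q := by
        have : 4 / ‖e‖ = 128 / D * q := by rw [hq]; field_simp; norm_num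
        rw [this]
        gcongr
      have h3 : 4 / ‖e‖ = 2 / ‖e‖ + 2 / ‖e‖ := by ring
      linarith
    obtain ⟨i, hi⟩ := exists_volume_real_le_mul_inter hkc.measure_lt_top.ne hq0 hN hksub
    set p := k ∩ Icc (t - 2 / ‖e‖ + i * q) (t - 2 / ‖e‖ + i * q + q) with hp
    have hN0 : (0 : ℝ) < N := by linarith
    have hppos : 0 < volume.real p := by
      by_contra! hcon
      have := mul_nonpos_of_nonneg_of_nonpos hN0.le hcon
      linarith
    obtain ⟨t₀, ht₀⟩ : p.Nonempty := by
      rw [nonempty_iff_ne_empty]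
      intro h
      rw [h] at hppos
      simp at hppos
    have hx := hJ1 t₀ (hsJ (hks ht₀.1))
    have key := hu.sub_le_of_le_on_line (a := a) (t₀ := t₀) (A := A) (B := C₁ * b) hq0 he
      ((closedBall_subset_closedBall (by rw [hqe]; linarith)).trans ((hball _ hx).trans hΩ))
      (fun z hz => hA' z (hball _ hx (closedBall_subset_closedBall (by rw [hqe]; linarith) hz)))
      (fun m' hm' => hB _ hx m' fun z hz => hm' z
        (closedBall_subset_closedBall (by rw [hqe]; linarith) hz)) hCb
      (hkc.inter_right isClosed_Icc)
      (fun t' ht' => ⟨by linarith [ht'.2.1, ht₀.2.2], by linarith [ht'.2.2, ht₀.2.1]⟩)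
      hppos (fun t ht => hm t (hks ht.1))
    refine ⟨A, fun t ht => hA _ (ball_subset_ball hr₁.le (hJ1 t ht)), ?_⟩
    have h1 : Real.log (q / volume.real p) ≤ Real.log N + y := by
      rw [hy, ← Real.log_mul hN0.ne' (by positivity)]
      refine Real.log_le_log (by positivity) ?_
      have h2 : volume.real s ≤ 2 * (N * volume.real p) := by linarith
      rw [hX, ← mul_div_assoc, div_le_div_iff₀ hppos hspos]
      calc q * volume.real s ≤ (l / 2) * (2 * (N * volume.real p)) := by
            gcongr
            linarith
        _ ≤ N * (4 * l) * volume.real p := by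
            have : 0 ≤ l * (N * volume.real p) := by positivity
            linarith
    have h2 : 4 + Real.log 2 + Real.log (q / volume.real p) ≤ 2 * ((5 + Real.log N) * y) := by
      nlinarith
    have h3 := mul_le_mul_of_nonneg_left h2 hCb
    linarith

/-! ### Complex lines in the ball and the conclusion. -/

theorem norm_sq_add_smul_of_inner_eq_zero {n : ℕ} {z₀ v : EuclideanSpace ℂ (Fin n)}
    (h : inner ℂ z₀ v = 0) (hv : ‖v‖ = 1) (ζ : ℂ) : ‖z₀ + ζ • v‖ ^ 2 = ‖z₀‖ ^ 2 + ‖ζ‖ ^ 2 := by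
  have := norm_add_sq_eq_norm_sq_add_norm_sq_of_inner_eq_zero z₀ (ζ • v)
    (𝕜 := ℂ) (by rw [inner_smul_right, h, mul_zero])
  rw [norm_smul, hv, mul_one] at this
  simpa only [sq] using this

theorem IsPlurisubharmonicOn.comp_line {n : ℕ} {f : EuclideanSpace ℂ (Fin n) → EReal}
    {Ω : Set (EuclideanSpace ℂ (Fin n))} (hf : IsPlurisubharmonicOn f Ω)
    (z₀ v : EuclideanSpace ℂ (Fin n)) :
    IsSubharmonicOn (fun ζ : ℂ => f (z₀ + ζ • v)) ((fun ζ : ℂ => z₀ + ζ • v) ⁻¹' Ω) where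
  upperSemicontinuousOn := hf.upperSemicontinuousOn.comp (by fun_prop) (fun _ h => h)
  ne_top z hz := hf.ne_top _ hz
  le_mean a w h := by
    have := hf.le_mean (z₀ + a • v) (w • v) fun ζ hζ => by
      have := h ζ hζ
      rwa [mem_preimage, add_smul, mul_smul, ← add_assoc] at this
    simpa only [add_smul, mul_smul, ← add_assoc] using this

theorem IsSubharmonicOn.mono {u : ℂ → EReal} {Ω Ω' : Set ℂ} (hu : IsSubharmonicOn u Ω)
    (h : Ω' ⊆ Ω) : IsSubharmonicOn u Ω' where
  upperSemicontinuousOn := hu.upperSemicontinuousOn.mono h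
  ne_top z hz := hu.ne_top z (h hz)
  le_mean a w hw := hu.le_mean a w fun ζ hζ => h (hw ζ hζ)

/-- What finiteness of the Bernstein index says on one complex line. -/
theorem exists_majorant_of_bernsteinIndex_ne_top {n : ℕ} {f : EuclideanSpace ℂ (Fin n) → EReal}
    {r₁ r : ℝ} (hr₁ : 1 < r₁) (hr : r₁ < r) (hf : IsPlurisubharmonicOn f (ball 0 r))
    (hb : bernsteinIndex f r₁ ≠ ⊤) {l : AffineSubspace ℂ (EuclideanSpace ℂ (Fin n))}
    (hl : Module.finrank ℂ l.direction = 1)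
    (hl1 : ((l : Set (EuclideanSpace ℂ (Fin n))) ∩ ball 0 1).Nonempty)
    (hbot : ¬ ∀ z ∈ (l : Set (EuclideanSpace ℂ (Fin n))) ∩ ball 0 r₁, f z = ⊥) :
    ∃ A : ℝ, (∀ z ∈ (l : Set (EuclideanSpace ℂ (Fin n))) ∩ ball 0 r₁, f z ≤ A) ∧
      ∀ m : ℝ, (∀ z ∈ (l : Set (EuclideanSpace ℂ (Fin n))) ∩ ball 0 1, f z ≤ m) →
        A - (bernsteinIndex f r₁).toReal ≤ m := by
  have hle : lineBernsteinIndex f r₁ l ≤ bernsteinIndex f r₁ :=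
    le_iSup₂ (f := fun (l : AffineSubspace ℂ (EuclideanSpace ℂ (Fin n)))
      (_ : Module.finrank ℂ l.direction = 1
        ∧ ((l : Set (EuclideanSpace ℂ (Fin n))) ∩ ball 0 1).Nonempty) =>
      lineBernsteinIndex f r₁ l) l ⟨hl, hl1⟩
  rw [lineBernsteinIndex, if_neg hbot] at hle
  set S₂ := ⨆ z ∈ (l : Set (EuclideanSpace ℂ (Fin n))) ∩ ball 0 r₁, f z with hS₂
  set S₁ := ⨆ z ∈ (l : Set (EuclideanSpace ℂ (Fin n))) ∩ ball 0 1, f z with hS₁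
  have hfS₂ : ∀ z ∈ (l : Set (EuclideanSpace ℂ (Fin n))) ∩ ball 0 r₁, f z ≤ S₂ :=
    fun z hz => le_iSup₂ (f := fun z _ => f z) z hz
  have h12 : S₁ ≤ S₂ := iSup₂_le fun z hz => hfS₂ z ⟨hz.1, ball_subset_ball hr₁.le hz.2⟩
  have h2bot : S₂ ≠ ⊥ := by
    intro h
    exact hbot fun z hz => le_bot_iff.1 (h ▸ hfS₂ z hz)
  -- The gap `r₁ < r` makes the closed ball compact inside the domain, so `f` is bounded above on
  -- it.
  have h2top : S₂ ≠ ⊤ := by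
    have hsub : closedBall (0 : EuclideanSpace ℂ (Fin n)) r₁ ⊆ ball 0 r :=
      closedBall_subset_ball hr
    obtain ⟨z₀, hz₀, hmax⟩ := (hf.upperSemicontinuousOn.mono hsub).exists_isMaxOn
      ⟨0, mem_closedBall_self (by linarith)⟩ (isCompact_closedBall 0 r₁)
    have : S₂ ≤ f z₀ := iSup₂_le fun z hz => hmax (ball_subset_closedBall hz.2)
    exact ne_top_of_le_ne_top (hf.ne_top z₀ (hsub hz₀)) this
  obtain ⟨A, hA⟩ : ∃ A : ℝ, (A : EReal) = S₂ := ⟨_, EReal.coe_toReal h2top h2bot⟩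
  rw [← hA] at hle h12
  have h1bot : S₁ ≠ ⊥ := by
    intro h
    rw [h, EReal.coe_sub_bot, top_le_iff] at hle
    exact hb hle
  obtain ⟨a, ha⟩ : ∃ a : ℝ, (a : EReal) = S₁ :=
    ⟨_, EReal.coe_toReal (ne_top_of_le_ne_top (EReal.coe_ne_top A) h12) h1bot⟩
  rw [← ha, ← EReal.coe_sub] at hle
  -- For `n = 0` there are no lines and the index is `⊥`; the given line rules this out.
  have hBbot : bernsteinIndex f r₁ ≠ ⊥ := ((EReal.bot_lt_coe _).trans_le hle).ne'
  rw [← EReal.coe_toReal hb hBbot, EReal.coe_le_coe_iff] at hle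
  refine ⟨A, fun z hz => hA ▸ hfS₂ z hz, fun m hm => ?_⟩
  have : S₁ ≤ m := iSup₂_le hm
  rw [← ha, EReal.coe_le_coe_iff] at this
  linarith

/-- Passage to the exponential. -/
theorem exp_iSup_le_rpow_mul {g : ℝ → EReal} {J s : Set ℝ} {X p : ℝ} (hX : 0 < X)
    (h : ∀ m : ℝ, (∀ t ∈ s, g t ≤ m) → ∀ t ∈ J, g t ≤ ((m + p * Real.log X : ℝ) : EReal)) :
    ⨆ t ∈ J, EReal.exp (g t) ≤ ENNReal.ofReal X ^ p * ⨆ t ∈ s, EReal.exp (g t) := by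
  have hexp : ⨆ t ∈ s, EReal.exp (g t) = EReal.exp (⨆ t ∈ s, g t) :=
    (EReal.expOrderIso.map_iSup₂ fun t _ => g t).symm
  have hpow : ENNReal.ofReal X ^ p = EReal.exp ((p * Real.log X : ℝ) : EReal) := by
    rw [ENNReal.ofReal_rpow_of_pos hX, Real.rpow_def_of_pos hX, EReal.exp_coe, mul_comm p]
  rw [hexp, hpow, ← EReal.exp_add]
  refine iSup₂_le fun t ht => EReal.exp_monotone ?_
  set M := ⨆ t ∈ s, g t with hM
  -- Testing against real `z` also covers `M = ⊥`, where the hypothesis is used with arbitrarily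
  -- negative bounds.
  refine EReal.le_of_forall_lt_iff_le.1 fun z hz => ?_
  have hMz : M ≤ ((z - p * Real.log X : ℝ) : EReal) := by
    rw [EReal.coe_sub]
    refine (EReal.le_sub_iff_add_le (Or.inl (EReal.coe_ne_bot _))
      (Or.inl (EReal.coe_ne_top _))).2 ?_
    rw [add_comm]
    exact hz.le
  have := h _ (fun t ht => (le_iSup₂ (f := fun t _ => g t) t ht).trans hMz) t ht
  rwa [sub_add_cancel] at this

theorem mainTheorem5 (r₁ r : ℝ) (hr₁ : 1 < r₁) (hr : r₁ < r) :
    ∃ c : ℝ, 1 ≤ c ∧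
      ∀ (n : ℕ) (f : EuclideanSpace ℂ (Fin n) → EReal),
        IsPlurisubharmonicOn f (ball 0 r) →
        bernsteinIndex f r₁ ≠ ⊤ →
          SatisfiesRemez (fun z => EReal.exp (f z)) (c * (bernsteinIndex f r₁).toReal) := by
  obtain ⟨C, hC, hrem⟩ := exists_remez_constant r₁ hr₁
  refine ⟨C, hC, ?_⟩
  intro n f hf hb x v hv J hJ hJ1 s hsJ hs hs0
  obtain ⟨t₀, ht₀⟩ : J.Nonempty := by
    rw [nonempty_iff_ne_empty]
    rintro rfl
    rw [subset_empty_iff] at hsJ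
    simp [hsJ] at hs0
  set l : AffineSubspace ℂ (EuclideanSpace ℂ (Fin n)) :=
    AffineSubspace.mk' x (Submodule.span ℂ {v}) with hl
  have hv0 : v ≠ 0 := by
    rintro rfl
    simp at hv
  have hmem : ∀ ζ : ℂ, x + ζ • v ∈ (l : Set (EuclideanSpace ℂ (Fin n))) := by
    intro ζ
    rw [SetLike.mem_coe, hl, AffineSubspace.mem_mk', vsub_eq_sub, add_sub_cancel_left]
    exact Submodule.smul_mem _ _ (Submodule.mem_span_singleton_self v)
  by_cases hbot : ∀ z ∈ (l : Set (EuclideanSpace ℂ (Fin n))) ∩ ball 0 r₁, f z = ⊥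
  · have : ⨆ t ∈ J, EReal.exp (f (x + (t : ℂ) • v)) ≤ 0 := iSup₂_le fun t ht => by
      rw [hbot _ ⟨hmem t, ball_subset_ball hr₁.le (hJ1 t ht)⟩, EReal.exp_bot]
    exact this.trans bot_le
  obtain ⟨A, hA, hAm⟩ := exists_majorant_of_bernsteinIndex_ne_top hr₁ hr hf hb (l := l)
    (by rw [hl, AffineSubspace.direction_mk', finrank_span_singleton hv0])
    ⟨_, hmem t₀, hJ1 t₀ ht₀⟩ hbot
  -- `z₀` is the foot of the perpendicular from the origin to the line, and `ρ` below is the radius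
  -- of the slice of the unit ball.
  set κ : ℂ := inner ℂ v x with hκ
  set z₀ : EuclideanSpace ℂ (Fin n) := x - κ • v with hz₀
  have horth : inner ℂ z₀ v = 0 := by
    rw [hz₀, inner_sub_left, inner_smul_left, hκ, inner_conj_symm, inner_self_eq_norm_sq_to_K, hv]
    simp
  have hnorm := norm_sq_add_smul_of_inner_eq_zero horth hv
  have hx : ∀ ζ : ℂ, x + ζ • v = z₀ + (κ + ζ) • v := by
    intro ζ
    rw [hz₀, add_smul]; abel
  have hd : ‖z₀‖ ^ 2 < 1 := by
    have h1 := hnorm (κ + t₀)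
    rw [← hx] at h1
    have h2 := mem_ball_zero_iff.1 (hJ1 t₀ ht₀)
    have h3 : ‖x + (t₀ : ℂ) • v‖ ^ 2 < 1 := pow_lt_one₀ (norm_nonneg _) h2 two_ne_zero
    nlinarith [sq_nonneg ‖κ + (t₀ : ℂ)‖]
  set ρ : ℝ := √(1 - ‖z₀‖ ^ 2) with hρ
  have hρ0 : 0 < ρ := Real.sqrt_pos.2 (by linarith)
  have hρ2 : ρ ^ 2 = 1 - ‖z₀‖ ^ 2 := Real.sq_sqrt (by linarith)
  have hρc : (ρ : ℂ) ≠ 0 := by exact_mod_cast hρ0.ne'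
  have hnormρ : ∀ ζ : ℂ, ‖z₀ + ζ • ((ρ : ℂ) • v)‖ ^ 2 = ‖z₀‖ ^ 2 + ρ ^ 2 * ‖ζ‖ ^ 2 := by
    intro ζ
    rw [smul_smul, hnorm, norm_mul, Complex.norm_real, Real.norm_of_nonneg hρ0.le]
    ring
  have hball1 : ∀ ζ : ℂ, z₀ + ζ • ((ρ : ℂ) • v) ∈ ball (0 : EuclideanSpace ℂ (Fin n)) 1 →
      ζ ∈ ball (0 : ℂ) 1 := by
    intro ζ h
    rw [mem_ball_zero_iff] at h ⊢
    have h1 := hnormρ ζ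
    have h2 := pow_lt_one₀ (norm_nonneg _) h two_ne_zero
    have h3 : ρ ^ 2 * ‖ζ‖ ^ 2 < ρ ^ 2 * 1 := by linarith
    have h4 := lt_of_mul_lt_mul_left h3 (by positivity)
    nlinarith [norm_nonneg ζ]
  have hballr : ∀ ζ ∈ ball (0 : ℂ) r₁,
      z₀ + ζ • ((ρ : ℂ) • v) ∈ ball (0 : EuclideanSpace ℂ (Fin n)) r₁ := by
    intro ζ h
    rw [mem_ball_zero_iff] at h ⊢
    have h1 := hnormρ ζ
    have h2 : ‖ζ‖ ^ 2 < r₁ ^ 2 := pow_lt_pow_left₀ h (norm_nonneg _) two_ne_zero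
    have h3 := mul_lt_mul_of_pos_left h2 (pow_pos hρ0 2)
    refine lt_of_pow_lt_pow_left₀ 2 (by linarith) ?_
    -- `‖z₀‖² + ρ² r₁² ≤ r₁²`, because `‖z₀‖² + ρ² = 1` and `r₁ > 1`.
    nlinarith [mul_nonneg (sq_nonneg ‖z₀‖) (show 0 ≤ r₁ ^ 2 - 1 by nlinarith)]
  have hline : ∀ ζ : ℂ, z₀ + ζ • ((ρ : ℂ) • v) ∈ (l : Set (EuclideanSpace ℂ (Fin n))) := by
    intro ζ
    have := hmem (ζ * ρ - κ)
    rwa [hx, add_sub_cancel, mul_smul] at this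
  have hparam : ∀ ζ : ℂ, x + ζ • v = z₀ + (κ / ρ + ζ * (ρ : ℂ)⁻¹) • ((ρ : ℂ) • v) := by
    intro ζ
    rw [hx, smul_smul]
    congr 2
    field_simp
  have hu : IsSubharmonicOn (fun ζ : ℂ => f (z₀ + ζ • ((ρ : ℂ) • v))) (ball 0 r₁) :=
    (hf.comp_line z₀ ((ρ : ℂ) • v)).mono fun ζ hζ => ball_subset_ball hr.le (hballr ζ hζ)
  have key := hrem _ hu A (bernsteinIndex f r₁).toReal
    (fun ζ hζ => hA _ ⟨hline ζ, hballr ζ hζ⟩)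
    (fun m hm => hAm m fun z hz => by
      obtain ⟨ζ, rfl⟩ : ∃ ζ : ℂ, z = x + ζ • v := by
        have h := hz.1
        rw [SetLike.mem_coe, hl, AffineSubspace.mem_mk', vsub_eq_sub,
          Submodule.mem_span_singleton] at h
        obtain ⟨ζ, hζ⟩ := h
        exact ⟨ζ, by rw [hζ]; abel⟩
      have h := hz.2
      rw [hparam] at h ⊢
      exact hm _ (hball1 _ h))
    (κ / ρ) (ρ : ℂ)⁻¹ (inv_ne_zero hρc) J hJ
    (fun t ht => hball1 _ (by rw [← hparam]; exact hJ1 t ht)) s hsJ hs hs0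
  simp only [← hparam] at key
  have hJfin : volume J ≠ ⊤ := by
    refine ne_top_of_le_ne_top (measure_ball_lt_top (x := t₀) (r := 2)).ne
      (measure_mono fun t ht => ?_)
    have h1 := dist_triangle_right (x + (t : ℂ) • v) (x + (t₀ : ℂ) • v) 0
    have h2 := mem_ball.1 (hJ1 t ht)
    have h3 := mem_ball.1 (hJ1 t₀ ht₀)
    rw [dist_add_left, dist_eq_norm (_ • v), ← sub_smul, norm_smul, hv, mul_one,
      ← Complex.ofReal_sub, Complex.norm_real, ← dist_eq_norm] at h1
    rw [mem_ball]
    linarith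
  have hsfin : volume s ≠ ⊤ := ne_top_of_le_ne_top hJfin (measure_mono hsJ)
  have hspos : 0 < volume.real s := ENNReal.toReal_pos hs0 hsfin
  have hJpos : 0 < volume.real J := hspos.trans_le (measureReal_mono hsJ hJfin)
  have hratio : 4 * volume J / volume s
      = ENNReal.ofReal (4 * volume.real J / volume.real s) := by
    rw [ENNReal.ofReal_div_of_pos hspos, ENNReal.ofReal_mul (by norm_num),
      ofReal_measureReal hJfin, ofReal_measureReal hsfin]
    norm_num
  rw [hratio]
  exact exp_iSup_le_rpow_mul (by positivity) key
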